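/- \textbf{Setting.} Let $G$ be a (finite-dimensional real) Lie group with Lie algebra $\mathfrak g$ (bracket of left-invariant vector fields), acting smoothly from the left on a smooth manifold $Q$, $\Phi_g(q)=gq$. Let $L:TQ\to\mathbb R$ be a $C^1$ Lagrangian that is $G$-invariant, $L\circ T\Phi_g=L$, and let $F:TQ\times\mathbb R^m\to T^*Q$ be a fibre-preserving control force that is $G$-equivariant, $\langle F(T\Phi_g v,u),T\Phi_g w\rangle=\langle F(v,u),w\rangle$ for $v,w\in T_qQ$. Let $\mathcal A:TQ\to\mathfrak g$ be a smooth principal connection: $\mathcal A(\xi_Q)=\xi$ for all $\xi\in\mathfrak g$, and $\mathcal A(T\Phi_g v)=\mathrm{Ad}_g\mathcal A(v)$. Its curvature is $B(v,w)=d\mathcal A(\mathrm{Hor}\,v,\mathrm{Hor}\,w)$, where $\mathrm{Hor}\,v=v-(\mathcal A(v))_Q$ and, in coordinates, $d\mathcal A(v,w)=(D_v\mathcal A)(w)-(D_w\mathcal A)(v)$. Let $\psi:Y\times G\to Q$, with $Y\subseteq\mathbb R^r$ open, be a local trivialization, i.e. a diffeomorphism onto an open subset of $Q$ with $\psi(y,hg)=h\,\psi(y,g)$.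 Write tangent vectors at $\psi(y,e)$ as pairs in $\mathbb R^r\times\mathfrak g$, and put $\mathcal A_e(y)v=\mathcal A_{(y,e)}(v,0)$. Fix a basis $(e_a)$ of $\mathfrak g$, with $[e_d,e_b]=c^a_{db}e_a$, and let $\mathcal A^a_\alpha(y)$ and $B^a_{\beta\alpha}(y)$ be the components along $e_a$ of $\mathcal A_e(y)\partial_\alpha$ and of $B_{(y,e)}\big((\partial_\beta,0),(\partial_\alpha,0)\big)$. With $p(y,v,\Omega)=\big((y,e),(v,\Omega-\mathcal A_e(y)v)\big)\in TQ$, define the reduced Lagrangian and the reduced forces by $$l(y,v,\Omega)=L(p(y,v,\Omega)),\qquad f_b(y,v,\Omega,u)=\big\langle F(p(y,v,\Omega),u),(0,e_b)\big\rangle,$$ $$f_\alpha(y,v,\Omega,u)=\big\langle F(p(y,v,\Omega),u),(\partial_\alpha,-\mathcal A_e(y)\partial_\alpha)\big\rangle .$$ \textbf{Statement.} Let $J\subseteq\mathbb R$ be open, let $y:J\to Y$ and $g:J\to G$ be differentiable curves, $q(t)=\psi(y(t),g(t))$, let $u:J\to\mathbb R^m$ be any control, and set $\Omega=\mathcal A_e(y)\dot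 y+g^{-1}\dot g$. Then, for every $t\in J$, the forced Euler--Lagrange equations $$\frac{d}{dt}\frac{\partial L}{\partial\dot q}(q,\dot q)-\frac{\partial L}{\partial q}(q,\dot q)=F(q,\dot q,u)$$ hold at $t$ (in every chart of $Q$ around $q(t)$) if and only if the forced Lagrange--Poincar\'e equations hold at $t$, that is, for all indices $b$ and $\alpha$ the vertical equation $$\frac{d}{dt}\frac{\partial l}{\partial\Omega^b}-\frac{\partial l}{\partial\Omega^a}\left(c^a_{db}\Omega^d-c^a_{db}\mathcal A^d_\alpha\dot y^\alpha\right)=f_b(y,\dot y,\Omega,u)$$ and the horizontal equation $$\frac{d}{dt}\frac{\partial l}{\partial\dot y^\alpha}-\frac{\partial l}{\partial y^\alpha}+\frac{\partial l}{\partial\Omega^a}\left(B^a_{\beta\alpha}\dot y^\beta+c^a_{db}\Omega^d\mathcal A^b_\alpha\right)=f_\alpha(y,\dot y,\Omega,u)$$ hold (repeated indices are summed; an equation with $d/dt$ includes the existence of that derivative). In particular, $q$ satisfies the forced Euler--Lagrange equations on $J$ if and only if it satisfies the forced Lagrange--Poincar\'e equations on $J$. -/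

import Mathlib

open scoped Manifold ContDiff

noncomputable section

namespace LagrangePoincare

variable {EG : Type*} [NormedAddCommGroup EG] [NormedSpace ℝ EG]
  (G : Type*) [TopologicalSpace G] [ChartedSpace EG G] [Group G]
  {EQ : Type*} [NormedAddCommGroup EQ] [NormedSpace ℝ EQ]
  (Q : Type*) [TopologicalSpace Q] [ChartedSpace EQ Q]

/-! ### Lagrangians, forces and their symmetries -/

variable {Q} in
/-- The tangent lift `TΦ_g : TQ → TQ` of the translation `Φ_g : q ↦ g • q`. -/
def liftAction [SMul G Q] (g : G) (p : TangentBundle 𝓘(ℝ, EQ) Q) : TangentBundle 𝓘(ℝ, EQ) Q :=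
  tangentMap 𝓘(ℝ, EQ) 𝓘(ℝ, EQ) (fun q : Q => g • q) p

variable {Q} in
/-- `L ∘ TΦ_g = L` for all `g`. -/
def InvariantLagrangian [SMul G Q] (L : TangentBundle 𝓘(ℝ, EQ) Q → ℝ) : Prop :=
  ∀ (g : G) (p : TangentBundle 𝓘(ℝ, EQ) Q), L (liftAction G g p) = L p

/-- A controlled force field `TQ × ℝᵐ → T*Q` over the identity of `Q`. -/
abbrev ControlForce (m : ℕ) : Type _ :=
  (p : TangentBundle 𝓘(ℝ, EQ) Q) → (Fin m → ℝ) → (TangentSpace 𝓘(ℝ, EQ) p.1 →L[ℝ] ℝ)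

variable {Q} in
/-- Equivariance for the tangent lift on `TQ` and the cotangent lift on `T*Q`:
`⟨F(TΦ_g p, u), TΦ_g w⟩ = ⟨F(p, u), w⟩`. -/
def EquivariantForce [SMul G Q] {m : ℕ} (F : ControlForce (EQ := EQ) Q m) : Prop :=
  ∀ (g : G) (p : TangentBundle 𝓘(ℝ, EQ) Q) (u : Fin m → ℝ) (w : TangentSpace 𝓘(ℝ, EQ) p.1),
    F (liftAction G g p) u (mfderiv 𝓘(ℝ, EQ) 𝓘(ℝ, EQ) (fun q : Q => g • q) p.1 w) = F p u w

/-! ### Forced Euler–Lagrange equations on a manifold -/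

section EulerLagrange

variable {Q}

/-- The coordinate expression `L(x, v)` of a Lagrangian in a chart `e`. -/
def coordLagrangian (L : TangentBundle 𝓘(ℝ, EQ) Q → ℝ) (e : OpenPartialHomeomorph Q EQ)
    (x v : EQ) : ℝ :=
  L (tangentMap 𝓘(ℝ, EQ) 𝓘(ℝ, EQ) e.symm ⟨x, v⟩)

/-- The coordinate expression `F(x, v, u)` of a force field in a chart `e`. -/
def coordForce {m : ℕ} (F : ControlForce (EQ := EQ) Q m) (e : OpenPartialHomeomorph Q EQ)
    (x v : EQ) (u : Fin m → ℝ) : EQ →L[ℝ] ℝ :=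
  (F (tangentMap 𝓘(ℝ, EQ) 𝓘(ℝ, EQ) e.symm ⟨x, v⟩) u).comp
    (mfderiv 𝓘(ℝ, EQ) 𝓘(ℝ, EQ) e.symm x)

/-- The forced Euler–Lagrange equations `d/dt (∂L/∂v) - ∂L/∂x = F` at time `t` along the curve `q`
with control `u`, in every chart of the smooth structure around `q t`. -/
def ForcedEulerLagrangeAt (L : TangentBundle 𝓘(ℝ, EQ) Q → ℝ) {m : ℕ}
    (F : ControlForce (EQ := EQ) Q m) (q : ℝ → Q) (u : ℝ → Fin m → ℝ) (t : ℝ) : Prop :=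
  ∀ e ∈ IsManifold.maximalAtlas 𝓘(ℝ, EQ) ∞ Q, q t ∈ e.source →
    HasDerivAt
      (fun s => fderiv ℝ (fun v => coordLagrangian L e (e (q s)) v) (deriv (fun r => e (q r)) s))
      (fderiv ℝ (fun x => coordLagrangian L e x (deriv (fun r => e (q r)) t)) (e (q t))
        + coordForce F e (e (q t)) (deriv (fun r => e (q r)) t) (u t))
      t

end EulerLagrange

/-! ### Principal connections and curvature -/

/-- The infinitesimal generator `ξ_Q(q)`, the velocity at the identity of the orbit map. -/
def infinitesimalGenerator [SMul G Q] (q : Q) :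
    GroupLieAlgebra 𝓘(ℝ, EG) G →L[ℝ] TangentSpace 𝓘(ℝ, EQ) q :=
  (mfderiv 𝓘(ℝ, EG) 𝓘(ℝ, EQ) (fun g : G => g • q) 1 : EG →L[ℝ] EQ)

/-- The adjoint action of `G` on its Lie algebra. -/
def adjointAction (g : G) :
    GroupLieAlgebra 𝓘(ℝ, EG) G →L[ℝ] GroupLieAlgebra 𝓘(ℝ, EG) G :=
  (mfderiv 𝓘(ℝ, EG) 𝓘(ℝ, EG) (fun h : G => g * h * g⁻¹) 1 : EG →L[ℝ] EG)

/-- A smooth principal connection on `Q`. -/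
structure PrincipalConnection [IsManifold 𝓘(ℝ, EQ) ∞ Q] [SMul G Q] where
  form : (q : Q) → TangentSpace 𝓘(ℝ, EQ) q →L[ℝ] GroupLieAlgebra 𝓘(ℝ, EG) G
  smooth : ContMDiff (M' := EG) 𝓘(ℝ, EQ).tangent 𝓘(ℝ, EG) ∞
    (fun p : TangentBundle 𝓘(ℝ, EQ) Q => form p.1 p.2)
  generator : ∀ (q : Q) (ξ : GroupLieAlgebra 𝓘(ℝ, EG) G),
    form q (infinitesimalGenerator G Q q ξ) = ξ
  equivariant : ∀ (g : G) (q : Q) (v : TangentSpace 𝓘(ℝ, EQ) q),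
    form (g • q) (mfderiv 𝓘(ℝ, EQ) 𝓘(ℝ, EQ) (fun q' : Q => g • q') q v)
      = adjointAction G g (form q v)

namespace PrincipalConnection

variable {G Q} [IsManifold 𝓘(ℝ, EQ) ∞ Q] [SMul G Q] (A : PrincipalConnection (EG := EG) (EQ := EQ) G Q)

/-- The coordinate expression of the connection form in the preferred chart around `q₀`. -/
def chartForm (q₀ : Q) (x : EQ) : EQ →L[ℝ] EG :=
  (A.form ((chartAt EQ q₀).symm x) : EQ →L[ℝ] EG).comp
    (mfderiv 𝓘(ℝ, EQ) 𝓘(ℝ, EQ) (chartAt EQ q₀).symm x : EQ →L[ℝ] EQ)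

/-- The exterior derivative of the connection form, `dA(v, w) = (D_v A)(w) - (D_w A)(v)` in
coordinates. -/
def exteriorDerivative (q : Q) (v w : TangentSpace 𝓘(ℝ, EQ) q) : GroupLieAlgebra 𝓘(ℝ, EG) G :=
  let dφ : EQ →L[ℝ] EQ := mfderiv 𝓘(ℝ, EQ) 𝓘(ℝ, EQ) (chartAt EQ q) q
  let D : EQ →L[ℝ] EQ →L[ℝ] EG := fderiv ℝ (A.chartForm q) (chartAt EQ q q)
  (D (dφ v) (dφ w) - D (dφ w) (dφ v) : EG)

/-- The horizontal component of a tangent vector. -/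
def hor (q : Q) (v : TangentSpace 𝓘(ℝ, EQ) q) : TangentSpace 𝓘(ℝ, EQ) q :=
  v - infinitesimalGenerator G Q q (A.form q v)

/-- The curvature `B(v, w) = dA(Hor v, Hor w)`. -/
def curvature (q : Q) (v w : TangentSpace 𝓘(ℝ, EQ) q) : GroupLieAlgebra 𝓘(ℝ, EG) G :=
  A.exteriorDerivative q (A.hor q v) (A.hor q w)

end PrincipalConnection

/-! ### Local trivializations -/

/-- A local trivialization `Y × G ≃ U ⊆ Q` of the `G`-manifold `Q`: a diffeomorphism onto an open
subset, with `Y ⊆ ℝʳ` open, that intertwines left multiplication on the factor `G` with the action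
on `Q`. -/
structure LocalTrivialization [SMul G Q] (r : ℕ) where
  base : Set (EuclideanSpace ℝ (Fin r))
  toHomeo : OpenPartialHomeomorph (EuclideanSpace ℝ (Fin r) × G) Q
  source_eq : toHomeo.source = base ×ˢ Set.univ
  smooth_toFun : ContMDiffOn (𝓘(ℝ, EuclideanSpace ℝ (Fin r)).prod 𝓘(ℝ, EG)) 𝓘(ℝ, EQ) ∞
    toHomeo toHomeo.source
  smooth_invFun : ContMDiffOn 𝓘(ℝ, EQ) (𝓘(ℝ, EuclideanSpace ℝ (Fin r)).prod 𝓘(ℝ, EG)) ∞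
    toHomeo.symm toHomeo.target
  equivariant : ∀ y ∈ base, ∀ h g : G, toHomeo (y, h * g) = h • toHomeo (y, g)

/-- The left-trivialized velocity `ξ = g⁻¹ ġ` of a curve in `G`. -/
def bodyVelocity {G : Type*} [TopologicalSpace G] [ChartedSpace EG G] [Group G]
    (g : ℝ → G) (t : ℝ) : GroupLieAlgebra 𝓘(ℝ, EG) G :=
  (mfderiv 𝓘(ℝ, EG) 𝓘(ℝ, EG) (fun h : G => (g t)⁻¹ * h) (g t) : EG →L[ℝ] EG)
    (mfderiv 𝓘(ℝ, ℝ) 𝓘(ℝ, EG) g t (1 : ℝ))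

variable {G Q} [IsManifold 𝓘(ℝ, EQ) ∞ Q] [SMul G Q]

namespace LocalTrivialization

variable {r : ℕ} (ψ : LocalTrivialization (EG := EG) (EQ := EQ) G Q r)

/-- The tangent vector of `Q` at `(y, e)` with components `(v, ξ) ∈ ℝʳ × 𝔤`. -/
def tangentVec (y v : EuclideanSpace ℝ (Fin r)) (ξ : GroupLieAlgebra 𝓘(ℝ, EG) G) :
    TangentSpace 𝓘(ℝ, EQ) (ψ.toHomeo (y, 1)) :=
  (mfderiv (𝓘(ℝ, EuclideanSpace ℝ (Fin r)).prod 𝓘(ℝ, EG)) 𝓘(ℝ, EQ) ψ.toHomeo (y, (1 : G)) :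
    (EuclideanSpace ℝ (Fin r) × EG) →L[ℝ] EQ) (v, ξ)

variable (A : PrincipalConnection (EG := EG) (EQ := EQ) G Q)

/-- The local connection form `A_e(y) v = A_{(y,e)}(v, 0)`. -/
def localConnection (y v : EuclideanSpace ℝ (Fin r)) : GroupLieAlgebra 𝓘(ℝ, EG) G :=
  A.form (ψ.toHomeo (y, 1)) (ψ.tangentVec y v 0)

/-- The point of `TQ` over `(y, e)` with `ẏ = v` and `A_e(y) v + ξ = Ω`. -/
def reducedPoint (y v : EuclideanSpace ℝ (Fin r)) (Ω : GroupLieAlgebra 𝓘(ℝ, EG) G) :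
    TangentBundle 𝓘(ℝ, EQ) Q :=
  ⟨ψ.toHomeo (y, 1), ψ.tangentVec y v (Ω - ψ.localConnection A y v)⟩

/-- The reduced Lagrangian `l(y, ẏ, Ω)`: the expression of `L` on
`TQ/G ≃ T(Q/G) ⊕ 𝔤̃` in the trivialization. -/
def reducedLagrangian (L : TangentBundle 𝓘(ℝ, EQ) Q → ℝ) (y v : EuclideanSpace ℝ (Fin r))
    (Ω : GroupLieAlgebra 𝓘(ℝ, EG) G) : ℝ :=
  L (ψ.reducedPoint A y v Ω)

/-- The vertical part of the reduced force, evaluated on the vertical variation `η ∈ 𝔤`. -/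
def verticalForce {m : ℕ} (F : ControlForce (EQ := EQ) Q m) (y v : EuclideanSpace ℝ (Fin r))
    (Ω : GroupLieAlgebra 𝓘(ℝ, EG) G) (u : Fin m → ℝ) (η : GroupLieAlgebra 𝓘(ℝ, EG) G) : ℝ :=
  F (ψ.reducedPoint A y v Ω) u (ψ.tangentVec y 0 η)

/-- The horizontal part of the reduced force, evaluated on the variation `δy ∈ ℝʳ`, that is, on its
horizontal lift `(δy, -A_e(y) δy)`. -/
def horizontalForce {m : ℕ} (F : ControlForce (EQ := EQ) Q m) (y v : EuclideanSpace ℝ (Fin r))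
    (Ω : GroupLieAlgebra 𝓘(ℝ, EG) G) (u : Fin m → ℝ) (δy : EuclideanSpace ℝ (Fin r)) : ℝ :=
  F (ψ.reducedPoint A y v Ω) u (ψ.tangentVec y δy (-ψ.localConnection A y δy))

/-- The curve `Ω = A_e(y) ẏ + g⁻¹ ġ`. -/
def verticalVelocity (y : ℝ → EuclideanSpace ℝ (Fin r)) (g : ℝ → G) (t : ℝ) :
    GroupLieAlgebra 𝓘(ℝ, EG) G :=
  ψ.localConnection A (y t) (deriv y t) + bodyVelocity g t

variable {ι : Type*} (e : Module.Basis ι ℝ (GroupLieAlgebra 𝓘(ℝ, EG) G))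

/-- The connection coefficients `A^a_α(y)`. -/
def connectionCoeff (y : EuclideanSpace ℝ (Fin r)) (a : ι) (α : Fin r) : ℝ :=
  e.repr (ψ.localConnection A y (EuclideanSpace.single α 1)) a

/-- The curvature coefficients `B^a_{βα}(y)`. -/
def curvatureCoeff (y : EuclideanSpace ℝ (Fin r)) (a : ι) (β α : Fin r) : ℝ :=
  e.repr (A.curvature (ψ.toHomeo (y, 1))
    (ψ.tangentVec y (EuclideanSpace.single β 1) 0)
    (ψ.tangentVec y (EuclideanSpace.single α 1) 0)) a

end LocalTrivialization

/-- The structure constants `c^a_{db}`: `[e_d, e_b] = ∑ a, c^a_{db} e_a`. -/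
def structureConst {ι : Type*} (e : Module.Basis ι ℝ (GroupLieAlgebra 𝓘(ℝ, EG) G)) (a d b : ι) :
    ℝ :=
  e.repr ⁅e d, e b⁆ a

/-! ### Forced Lagrange–Poincaré equations -/

section Equations

variable {r : ℕ} (ψ : LocalTrivialization (EG := EG) (EQ := EQ) G Q r)
  (A : PrincipalConnection (EG := EG) (EQ := EQ) G Q)
  {ι : Type*} [Fintype ι] (e : Module.Basis ι ℝ (GroupLieAlgebra 𝓘(ℝ, EG) G))
  (L : TangentBundle 𝓘(ℝ, EQ) Q → ℝ) {m : ℕ} (F : ControlForce (EQ := EQ) Q m)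
  (y : ℝ → EuclideanSpace ℝ (Fin r)) (g : ℝ → G)

/-- `∂l/∂Ω^a` at time `t` along the curve. -/
def partialOmega (a : ι) (t : ℝ) : ℝ :=
  lineDeriv ℝ (fun Ω => ψ.reducedLagrangian A L (y t) (deriv y t) Ω)
    (ψ.verticalVelocity A y g t) (e a)

/-- `∂l/∂ẏ^α` at time `t` along the curve. -/
def partialVelocity (α : Fin r) (t : ℝ) : ℝ :=
  lineDeriv ℝ (fun v => ψ.reducedLagrangian A L (y t) v (ψ.verticalVelocity A y g t))
    (deriv y t) (EuclideanSpace.single α 1)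

/-- `∂l/∂y^α` at time `t` along the curve. -/
def partialPosition (α : Fin r) (t : ℝ) : ℝ :=
  lineDeriv ℝ (fun z => ψ.reducedLagrangian A L z (deriv y t) (ψ.verticalVelocity A y g t))
    (y t) (EuclideanSpace.single α 1)

/-- The vertical equation with index `b`:
`d/dt ∂l/∂Ω^b - ∂l/∂Ω^a (c^a_{db} Ω^d - c^a_{db} A^d_α ẏ^α) = f_b`. -/
def VerticalEquationAt (u : ℝ → Fin m → ℝ) (b : ι) (t : ℝ) : Prop :=
  DifferentiableAt ℝ (partialOmega ψ A e L y g b) t ∧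
  deriv (partialOmega ψ A e L y g b) t
    - ∑ a, partialOmega ψ A e L y g a t *
        (∑ d, structureConst e a d b * e.repr (ψ.verticalVelocity A y g t) d
          - ∑ d, ∑ α, structureConst e a d b * ψ.connectionCoeff A e (y t) d α * deriv y t α)
    = ψ.verticalForce A F (y t) (deriv y t) (ψ.verticalVelocity A y g t) (u t) (e b)

/-- The horizontal equation with index `α`:
`d/dt ∂l/∂ẏ^α - ∂l/∂y^α + ∂l/∂Ω^a (B^a_{βα} ẏ^β + c^a_{db} Ω^d A^b_α) = f_α`. -/
def HorizontalEquationAt (u : ℝ → Fin m → ℝ) (α : Fin r) (t : ℝ) : Prop :=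
  DifferentiableAt ℝ (partialVelocity ψ A L y g α) t ∧
  deriv (partialVelocity ψ A L y g α) t - partialPosition ψ A L y g α t
    + ∑ a, partialOmega ψ A e L y g a t *
        (∑ β, ψ.curvatureCoeff A e (y t) a β α * deriv y t β
          + ∑ d, ∑ b, structureConst e a d b * e.repr (ψ.verticalVelocity A y g t) d *
              ψ.connectionCoeff A e (y t) b α)
    = ψ.horizontalForce A F (y t) (deriv y t) (ψ.verticalVelocity A y g t) (u t)
        (EuclideanSpace.single α 1)

/-- The forced Lagrange–Poincaré equations at time `t`. -/
def ForcedLagrangePoincareAt (u : ℝ → Fin m → ℝ) (t : ℝ) : Prop :=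
  (∀ b, VerticalEquationAt ψ A e L F y g u b t) ∧
    ∀ α, HorizontalEquationAt ψ A e L F y g u α t

end Equations

end LagrangePoincare

end

/-!
The equivalence holds because both systems are one covariant equation, read in two coordinate
systems on `TQ`.

Given a frame `X` of the tangent bundle, the Euler–Lagrange equations are equivalent to Hamel's
equations (`eulerLagrangeAt_iff_hamel`): the momentum paired with each frame field `X η` has
derivative `∂ℓ/∂x · X η + ∂ℓ/∂w · γ(w, η) + F(X η)`, where `w` is the velocity in the frame,
`ℓ(x, w) = L(x, X(x) w)` and `γ` is the bracket of frame fields. Neither this nor the covariance of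
the equations under changes of charts (`EulerLagrangeAt.pullback`) involves a second derivative of
the curve, so curves that are merely differentiable are allowed: the momentum is differentiated as a
whole, together with the smooth coefficients of the frame.

The Lagrange–Poincaré equations are Hamel's equations for the frame `(v, Ω) ↦ (v, g (Ω - A_e(y) v))`
of `Y × G` (`trivFrame`), in which the velocity of the curve is `(ẏ, Ω)`. By invariance `ℓ` is the
reduced Lagrangian, which does not depend on `g` (`paramLagrangian_trivFrame`), and by equivariance
the force has the components `f_b` and `f_α` (`paramForce_chart_symm`). The bracket term is
`[Ω - A ẏ, e_b]` for the vertical fields, and `-B(ẏ, ∂_α) - [Ω, A_α]` for the horizontal ones,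
by the structure equation `B(v, u) = dA_e(v, u) - [A_e v, A_e u]` (`curvature_eq_localCurvature`).
The latter follows by differentiating the identity `A(X_u) = 0` for the horizontal fields `X_u`, which
spares differentiating `Ad`.

The only chart of `G` in use is the preferred one at the identity. At time `t`, the trivialization
is translated by `g t` (`LocalTrivialization.chart`), so that the curve passes through the identity
of `G`, where the bracket of left-invariant fields is the Lie algebra bracket by definition
(`lie_eq_chartBracket`).
-/

noncomputable section

namespace LagrangePoincare

open Filter Topology Function

/-! ### Euler–Lagrange equations in a normed space -/

section Calculus

variable {E : Type*} [NormedAddCommGroup E] [NormedSpace ℝ E]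
  {E' : Type*} [NormedAddCommGroup E'] [NormedSpace ℝ E']

/-- The forced Euler–Lagrange equations at time `t` in a normed space, with the value `f` of the
force at that time. -/
def EulerLagrangeAt (Λ : E → E → ℝ) (f : E →L[ℝ] ℝ) (x : ℝ → E) (t : ℝ) : Prop :=
  HasDerivAt (fun s => fderiv ℝ (Λ (x s)) (deriv x s))
    (fderiv ℝ (fun z => Λ z (deriv x t)) (x t) + f) t

theorem EulerLagrangeAt.congr {Λ Λ' : E → E → ℝ} {f : E →L[ℝ] ℝ} {x x' : ℝ → E} {t : ℝ}
    (hx : ContinuousAt x t) (hΛ : ∀ᶠ z in 𝓝 (x t), Λ z = Λ' z) (hxx : x =ᶠ[𝓝 t] x')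
    (h : EulerLagrangeAt Λ f x t) : EulerLagrangeAt Λ' f x' t := by
  unfold EulerLagrangeAt at h ⊢
  have h1 : fderiv ℝ (fun z => Λ' z (deriv x' t)) (x' t)
      = fderiv ℝ (fun z => Λ z (deriv x t)) (x t) := by
    rw [← hxx.deriv_eq, ← hxx.eq_of_nhds]
    refine Filter.EventuallyEq.fderiv_eq ?_
    filter_upwards [hΛ] with z hz
    rw [hz]
  rw [h1]
  refine h.congr_of_eventuallyEq ?_
  filter_upwards [hx.eventually hΛ, hxx.eventuallyEq_nhds] with s hs hs'
  rw [hs, hs'.eq_of_nhds, hs'.deriv_eq]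

theorem hasFDerivAt_uncurry_right {F : Type*} [NormedAddCommGroup F] [NormedSpace ℝ F]
    {Λ : E → E' → F} {z : E} {v : E'}
    (h : DifferentiableAt ℝ (uncurry Λ) (z, v)) :
    HasFDerivAt (Λ z) ((fderiv ℝ (uncurry Λ) (z, v)).comp (.inr ℝ E E')) v :=
  HasFDerivAt.comp v (g := uncurry Λ) (f := fun v => (z, v)) h.hasFDerivAt
    (hasFDerivAt_prodMk_right z v)

theorem hasFDerivAt_uncurry_left {F : Type*} [NormedAddCommGroup F] [NormedSpace ℝ F]
    {Λ : E → E' → F} {z : E} {v : E'}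
    (h : DifferentiableAt ℝ (uncurry Λ) (z, v)) :
    HasFDerivAt (fun z => Λ z v) ((fderiv ℝ (uncurry Λ) (z, v)).comp (.inl ℝ E E')) z :=
  HasFDerivAt.comp z (g := uncurry Λ) (f := fun z => (z, v)) h.hasFDerivAt
    (hasFDerivAt_prodMk_left z v)

/-- The chain rule for `z ↦ Λ (Ψ z) (X z w)`. -/
theorem hasFDerivAt_comp_frame {W : Type*} [NormedAddCommGroup W] [NormedSpace ℝ W]
    {Λ : E' → E' → ℝ} {Ψ : E → E'} {X : E → W →L[ℝ] E'} {z : E} {w : W}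
    (hΛ : DifferentiableAt ℝ (uncurry Λ) (Ψ z, X z w)) (hΨ : DifferentiableAt ℝ Ψ z)
    (hX : DifferentiableAt ℝ X z) :
    HasFDerivAt (fun z => Λ (Ψ z) (X z w))
      ((fderiv ℝ (fun y => Λ y (X z w)) (Ψ z)).comp (fderiv ℝ Ψ z)
        + (fderiv ℝ (Λ (Ψ z)) (X z w)).comp ((fderiv ℝ X z).flip w)) z := by
  have h1 : HasFDerivAt (fun z => (Ψ z, X z w))
      ((fderiv ℝ Ψ z).prod ((fderiv ℝ X z).flip w)) z :=
    hΨ.hasFDerivAt.prodMk (by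
      have := hX.hasFDerivAt.clm_apply (hasFDerivAt_const w z)
      simpa using this)
  have h2 := HasFDerivAt.comp z (g := uncurry Λ) (f := fun z => (Ψ z, X z w)) hΛ.hasFDerivAt h1
  refine h2.congr_fderiv ?_
  rw [(hasFDerivAt_uncurry_right hΛ).fderiv, (hasFDerivAt_uncurry_left hΛ).fderiv]
  ext d
  simp [← map_add]

/-- The Euler–Lagrange equations are covariant under smooth maps; no second derivative of the curve
is involved, since the second derivative of `Ψ` is symmetric. -/
theorem EulerLagrangeAt.pullback {Λ : E → E → ℝ} {Λ' : E' → E' → ℝ} {Ψ : E → E'}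
    {f : E' →L[ℝ] ℝ} {x : ℝ → E} {t : ℝ}
    (hΨ : ContDiffAt ℝ 2 Ψ (x t))
    (hΛ' : ∀ᶠ z in 𝓝 (Ψ (x t)), ∀ v, DifferentiableAt ℝ (uncurry Λ') (z, v))
    (hΛ : ∀ᶠ z in 𝓝 (x t), ∀ v, Λ z v = Λ' (Ψ z) (fderiv ℝ Ψ z v))
    (hx : ∀ᶠ s in 𝓝 t, DifferentiableAt ℝ x s)
    (h : EulerLagrangeAt Λ' f (fun s => Ψ (x s)) t) :
    EulerLagrangeAt Λ (f.comp (fderiv ℝ Ψ (x t))) x t := by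
  have hxt := hx.self_of_nhds
  have hΨd : ∀ᶠ z in 𝓝 (x t), DifferentiableAt ℝ Ψ z := by
    filter_upwards [hΨ.eventually (by simp)] with z hz using hz.differentiableAt (by simp)
  have hDΨ : DifferentiableAt ℝ (fderiv ℝ Ψ) (x t) :=
    (hΨ.fderiv_right (m := 1) (by norm_num)).differentiableAt (by simp)
  have hvel : ∀ᶠ s in 𝓝 t, deriv (fun s => Ψ (x s)) s = fderiv ℝ Ψ (x s) (deriv x s) := by
    filter_upwards [hx, hxt.continuousAt.eventually hΨd] with s h1 h2
    exact (h2.hasFDerivAt.comp_hasDerivAt s h1.hasDerivAt).deriv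
  have hmom : (fun s => fderiv ℝ (Λ (x s)) (deriv x s)) =ᶠ[𝓝 t]
      fun s => (fderiv ℝ (Λ' (Ψ (x s))) (deriv (fun s => Ψ (x s)) s)).comp
        (fderiv ℝ Ψ (x s)) := by
    filter_upwards [hvel, hxt.continuousAt.eventually hΛ,
      (hΨ.continuousAt.comp hxt.continuousAt).eventually hΛ'] with s h1 h2 h3
    have : Λ (x s) = fun v => Λ' (Ψ (x s)) (fderiv ℝ Ψ (x s) v) := funext h2
    rw [this, h1]
    exact ((hasFDerivAt_uncurry_right (h3 _)).differentiableAt.hasFDerivAt.comp _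
      (fderiv ℝ Ψ (x s)).hasFDerivAt).fderiv
  have hX := hasFDerivAt_comp_frame (Ψ := Ψ) (X := fderiv ℝ Ψ) (z := x t) (w := deriv x t)
    (hΛ'.self_of_nhds _) hΨd.self_of_nhds hDΨ
  have hX' : fderiv ℝ (fun z => Λ z (deriv x t)) (x t) = _ :=
    Eq.trans (EventuallyEq.fderiv_eq (hΛ.mono fun z hz => hz _)) hX.fderiv
  have h2 := HasDerivAt.clm_comp h (hDΨ.hasFDerivAt.comp_hasDerivAt t hxt.hasDerivAt)
  refine (h2.congr_of_eventuallyEq hmom).congr_deriv ?_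
  rw [hX', hvel.self_of_nhds]
  ext d
  have hs : fderiv ℝ (fderiv ℝ Ψ) (x t) (deriv x t) d = fderiv ℝ (fderiv ℝ Ψ) (x t) d (deriv x t) :=
    (hΨ.isSymmSndFDerivAt (by simp)).eq _ _
  simp [hs]
  ring

/-- **Hamel's equations**: the Euler–Lagrange equations in terms of the velocities `w` with respect
to a frame `X`, where `γ η` stands for the bracket of the frame fields `X w` and `X η` at the point
under consideration. -/
theorem eulerLagrangeAt_iff_hamel [CompleteSpace E] {Λ : E → E → ℝ} {f : E →L[ℝ] ℝ}
    {x w : ℝ → E} {t : ℝ} {X : E → E →L[ℝ] E} {γ : E →L[ℝ] E}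
    (hΛ : ∀ᶠ z in 𝓝 (x t), ∀ v, DifferentiableAt ℝ (uncurry Λ) (z, v))
    (hx : ∀ᶠ s in 𝓝 t, DifferentiableAt ℝ x s)
    (hX : DifferentiableAt ℝ X (x t)) (hunit : IsUnit (X (x t)))
    (hw : ∀ᶠ s in 𝓝 t, deriv x s = X (x s) (w s))
    (hγ : ∀ η, X (x t) (γ η)
      = fderiv ℝ X (x t) (X (x t) (w t)) η - fderiv ℝ X (x t) (X (x t) η) (w t)) :
    EulerLagrangeAt Λ f x t ↔
      HasDerivAt (fun s => fderiv ℝ (fun w => Λ (x s) (X (x s) w)) (w s))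
        ((fderiv ℝ (fun z => Λ z (X z (w t))) (x t)).comp (X (x t))
          + (fderiv ℝ (fun w => Λ (x t) (X (x t) w)) (w t)).comp γ + f.comp (X (x t))) t := by
  have hxt := hx.self_of_nhds
  have hwt := hw.self_of_nhds
  have hmom : (fun s => fderiv ℝ (fun w => Λ (x s) (X (x s) w)) (w s)) =ᶠ[𝓝 t]
      fun s => (fderiv ℝ (Λ (x s)) (deriv x s)).comp (X (x s)) := by
    filter_upwards [hw, hxt.continuousAt.eventually hΛ] with s h1 h2
    rw [h1]
    exact ((hasFDerivAt_uncurry_right (h2 _)).differentiableAt.hasFDerivAt.comp _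
      (X (x s)).hasFDerivAt).fderiv
  have hXx : HasDerivAt (fun s => X (x s)) (fderiv ℝ X (x t) (deriv x t)) t :=
    hX.hasFDerivAt.comp_hasDerivAt t hxt.hasDerivAt
  have hpos := (hasFDerivAt_comp_frame (Ψ := id) (X := X) (z := x t) (w := w t)
    (hΛ.self_of_nhds _) differentiableAt_id hX).fderiv
  simp only [id] at hpos
  -- The derivative of `p ∘ X`, where `p` is the momentum.
  have key : ((fderiv ℝ (fun z => Λ z (deriv x t)) (x t) + f).comp (X (x t)) +
      (fderiv ℝ (Λ (x t)) (deriv x t)).comp (fderiv ℝ X (x t) (deriv x t)))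
      = ((fderiv ℝ (fun z => Λ z (X z (w t))) (x t)).comp (X (x t))
          + (fderiv ℝ (fun w => Λ (x t) (X (x t) w)) (w t)).comp γ + f.comp (X (x t))) := by
    have hm : fderiv ℝ (fun w => Λ (x t) (X (x t) w)) (w t)
        = (fderiv ℝ (Λ (x t)) (deriv x t)).comp (X (x t)) := hmom.self_of_nhds
    rw [hpos, hm]
    ext η
    simp [hwt, hγ, fderiv_id]
    ring
  constructor
  · intro h
    exact ((HasDerivAt.clm_comp h hXx).congr_of_eventuallyEq hmom).congr_deriv key
  · intro h
    have h1 := (h.congr_of_eventuallyEq hmom.symm)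
    rw [← key] at h1
    obtain ⟨a, ha⟩ := hunit
    -- The momentum is `(p ∘ X) ∘ X⁻¹` near `t`, invertibility being an open condition, so it is
    -- differentiable because `p ∘ X` is.
    have hinv : DifferentiableAt ℝ (fun s => Ring.inverse (X (x s))) t := by
      refine DifferentiableAt.comp t (g := Ring.inverse) (f := fun s => X (x s)) ?_
        hXx.differentiableAt
      rw [← ha]
      exact differentiableAt_inverse (𝕜 := ℝ) a.isUnit
    have hev : ∀ᶠ s in 𝓝 t, IsUnit (X (x s)) := by
      have : {T : E →L[ℝ] E | IsUnit T} ∈ 𝓝 (X (x t)) := Units.isOpen.mem_nhds ⟨a, ha⟩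
      exact hXx.continuousAt.eventually this
    have hp : DifferentiableAt ℝ (fun s => fderiv ℝ (Λ (x s)) (deriv x s)) t := by
      refine (h1.differentiableAt.clm_comp hinv).congr_of_eventuallyEq ?_
      filter_upwards [hev] with s hs
      rw [ContinuousLinearMap.comp_assoc]
      have : (X (x s)).comp (Ring.inverse (X (x s))) = 1 := Ring.mul_inverse_cancel _ hs
      rw [this]
      rfl
    have h2 := (HasDerivAt.clm_comp hp.hasDerivAt hXx).unique h1
    have h3 : deriv (fun s => fderiv ℝ (Λ (x s)) (deriv x s)) t
        = fderiv ℝ (fun z => Λ z (deriv x t)) (x t) + f := by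
      have h4 := add_right_cancel h2
      ext d
      have := DFunLike.congr_fun h4 ((↑a⁻¹ : E →L[ℝ] E) d)
      have hc : X (x t) ((↑a⁻¹ : E →L[ℝ] E) d) = d := by
        rw [← ha]
        exact DFunLike.congr_fun a.mul_inv d
      simpa [hc] using this
    unfold EulerLagrangeAt
    rw [← h3]
    exact hp.hasDerivAt

end Calculus

/-! ### Hamel's equations on a product -/

section Trivialized

theorem hasDerivAt_clm_iff {E : Type*} [NormedAddCommGroup E] [NormedSpace ℝ E]
    {κ : Type*} [Fintype κ] (b : Module.Basis κ ℝ E) {p : ℝ → E →L[ℝ] ℝ} {P : E →L[ℝ] ℝ} {t : ℝ} :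
    HasDerivAt p P t ↔ ∀ i, HasDerivAt (fun s => p s (b i)) (P (b i)) t := by
  constructor
  · intro h i
    simpa using h.clm_apply (hasDerivAt_const t (b i))
  · intro h
    have : FiniteDimensional ℝ E := b.finiteDimensional_of_finite
    have key : ∀ T : E →L[ℝ] ℝ,
        T = ∑ i, T (b i) • LinearMap.toContinuousLinearMap (b.coord i) := by
      intro T
      ext d
      conv_lhs => rw [← b.sum_repr d]
      rw [map_sum]
      simp [mul_comm]
    rw [key P, show p = fun s => _ from funext fun s => key (p s)]
    exact HasDerivAt.fun_sum fun i _ =>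
      (h i).smul_const (LinearMap.toContinuousLinearMap (b.coord i) : E →L[ℝ] ℝ)

variable {Y V : Type*} [NormedAddCommGroup Y] [NormedSpace ℝ Y]
  [NormedAddCommGroup V] [NormedSpace ℝ V]

/-- The frame `(v, Ω) ↦ (v, M(x)(Ω - 𝒜(y) v))` of `Y × V`, where `M(x)` is the derivative of the
left translation by `x` in a chart of the group: it sends `(ẏ, Ω)` to the velocity of the curve. -/
def trivFrame (M : V → V →L[ℝ] V) (𝒜 : Y → Y →L[ℝ] V) (z : Y × V) : Y × V →L[ℝ] Y × V :=
  (ContinuousLinearMap.fst ℝ Y V).prod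
    ((M z.2).comp (.snd ℝ Y V - (𝒜 z.1).comp (.fst ℝ Y V)))

@[simp] theorem trivFrame_apply (M : V → V →L[ℝ] V) (𝒜 : Y → Y →L[ℝ] V) (z w : Y × V) :
    trivFrame M 𝒜 z w = (w.1, M z.2 (w.2 - 𝒜 z.1 w.1)) := rfl

theorem fderiv_trivFrame {M : V → V →L[ℝ] V} {𝒜 : Y → Y →L[ℝ] V} {z : Y × V}
    (hM : DifferentiableAt ℝ M z.2) (hA : DifferentiableAt ℝ 𝒜 z.1) :
    DifferentiableAt ℝ (trivFrame M 𝒜) z ∧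
    ∀ d w, fderiv ℝ (trivFrame M 𝒜) z d w
      = (0, fderiv ℝ M z.2 d.2 (w.2 - 𝒜 z.1 w.1) - M z.2 (fderiv ℝ 𝒜 z.1 d.1 w.1)) := by
  have h1 : HasFDerivAt (fun z : Y × V => M z.2) ((fderiv ℝ M z.2).comp (.snd ℝ Y V)) z :=
    hM.hasFDerivAt.comp z hasFDerivAt_snd
  have h2 : HasFDerivAt (fun z : Y × V => 𝒜 z.1) ((fderiv ℝ 𝒜 z.1).comp (.fst ℝ Y V)) z :=
    hA.hasFDerivAt.comp z hasFDerivAt_fst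
  have h3 : DifferentiableAt ℝ (fun z : Y × V =>
      ((.snd ℝ Y V - (𝒜 z.1).comp (.fst ℝ Y V) : Y × V →L[ℝ] V))) z :=
    (differentiableAt_const _).sub (h2.differentiableAt.clm_comp (differentiableAt_const _))
  have hX : DifferentiableAt ℝ (trivFrame M 𝒜) z := by
    have : trivFrame M 𝒜 = fun z => (ContinuousLinearMap.inl ℝ Y V).comp (.fst ℝ Y V)
        + (ContinuousLinearMap.inr ℝ Y V).comp
          ((M z.2).comp (.snd ℝ Y V - (𝒜 z.1).comp (.fst ℝ Y V))) := by
      ext z w <;> simp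
    rw [this]
    exact (differentiableAt_const _).add
      ((differentiableAt_const _).clm_comp (h1.differentiableAt.clm_comp h3))
  refine ⟨hX, fun d w => ?_⟩
  have e1 := hX.hasFDerivAt.clm_apply (hasFDerivAt_const w z)
  have e2 : HasFDerivAt (fun z : Y × V => w.2 - 𝒜 z.1 w.1)
      (0 - ((fderiv ℝ 𝒜 z.1).comp (.fst ℝ Y V)).flip w.1) z := by
    refine (hasFDerivAt_const w.2 z).sub ?_
    simpa using h2.clm_apply (hasFDerivAt_const w.1 z)
  have e3 := (hasFDerivAt_const w.1 z).prodMk (h1.clm_apply e2)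
  have := DFunLike.congr_fun (e1.unique e3) d
  simp only [ContinuousLinearMap.comp_zero, zero_add, ContinuousLinearMap.flip_apply] at this
  rw [this]
  simp [sub_eq_add_neg, add_comm]

/-- The Lie bracket at the identity of the left-invariant vector fields `M(x) ξ` and `M(x) η`, in a
chart in which the identity is `x`. -/
def chartBracket (M : V → V →L[ℝ] V) (x ξ η : V) : V := fderiv ℝ M x ξ η - fderiv ℝ M x η ξ

/-- The curvature form `d𝒜(v, u) - [𝒜 v, 𝒜 u]` of the local connection form. -/
def localCurvature (M : V → V →L[ℝ] V) (𝒜 : Y → Y →L[ℝ] V) (z : Y × V) (v u : Y) : V :=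
  fderiv ℝ 𝒜 z.1 v u - fderiv ℝ 𝒜 z.1 u v - chartBracket M z.2 (𝒜 z.1 v) (𝒜 z.1 u)

/-- The Euler–Lagrange equations in a local trivialization, in the frame `trivFrame`. Here `l` is
the reduced Lagrangian, `(v, Ω) = w t`, and the group component of `x t` is the identity. -/
theorem eulerLagrangeAt_iff_trivialized [FiniteDimensional ℝ Y] [FiniteDimensional ℝ V]
    {Λ : Y × V → Y × V → ℝ} {l : Y → Y × V → ℝ}
    {f : Y × V →L[ℝ] ℝ} {x w : ℝ → Y × V} {t : ℝ} {M : V → V →L[ℝ] V} {𝒜 : Y → Y →L[ℝ] V}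
    (hΛ : ∀ᶠ z in 𝓝 (x t), ∀ v, DifferentiableAt ℝ (uncurry Λ) (z, v))
    (hx : ∀ᶠ s in 𝓝 t, DifferentiableAt ℝ x s)
    (hM : DifferentiableAt ℝ M (x t).2) (hA : DifferentiableAt ℝ 𝒜 (x t).1)
    (hM1 : ∀ ξ, M (x t).2 ξ = ξ)
    (hw : ∀ᶠ s in 𝓝 t, deriv x s = trivFrame M 𝒜 (x s) (w s))
    (hl : ∀ᶠ z in 𝓝 (x t), ∀ w, Λ z (trivFrame M 𝒜 z w) = l z.1 w)
    (hld : DifferentiableAt ℝ (fun y => l y (w t)) (x t).1)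
    {κ : Type*} [Fintype κ] (b : Module.Basis κ ℝ (Y × V)) :
    EulerLagrangeAt Λ f x t ↔ ∀ i,
      HasDerivAt (fun s => fderiv ℝ (l (x s).1) (w s) (b i))
        (fderiv ℝ (fun y => l y (w t)) (x t).1 (b i).1
          + fderiv ℝ (l (x t).1) (w t) (0, chartBracket M (x t).2 ((w t).2 - 𝒜 (x t).1 (w t).1)
              ((b i).2 - 𝒜 (x t).1 (b i).1)
            - (fderiv ℝ 𝒜 (x t).1 (w t).1 (b i).1 - fderiv ℝ 𝒜 (x t).1 (b i).1 (w t).1))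
          + f ((b i).1, (b i).2 - 𝒜 (x t).1 (b i).1)) t := by
  have hxt := hx.self_of_nhds
  obtain ⟨hX, hDX⟩ := fderiv_trivFrame hM hA
  have hunit : IsUnit (trivFrame M 𝒜 (x t)) := by
    refine isUnit_iff_exists.2 ⟨(ContinuousLinearMap.fst ℝ Y V).prod
      (.snd ℝ Y V + (𝒜 (x t).1).comp (.fst ℝ Y V)), ?_, ?_⟩ <;>
    · ext w <;> simp [hM1]
  let τ : Y × V →L[ℝ] V := .snd ℝ Y V - (𝒜 (x t).1).comp (.fst ℝ Y V)
  let γ : Y × V →L[ℝ] Y × V := (ContinuousLinearMap.inr ℝ Y V).comp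
    ((fderiv ℝ M (x t).2 (τ (w t))).comp τ
      - ((fderiv ℝ M (x t).2).flip (τ (w t))).comp τ
      - ((fderiv ℝ 𝒜 (x t).1 (w t).1).comp (.fst ℝ Y V)
        - ((fderiv ℝ 𝒜 (x t).1).flip (w t).1).comp (.fst ℝ Y V)))
  have hγ : ∀ η, γ η = (0, chartBracket M (x t).2 ((w t).2 - 𝒜 (x t).1 (w t).1)
              (η.2 - 𝒜 (x t).1 η.1)
            - (fderiv ℝ 𝒜 (x t).1 (w t).1 η.1 - fderiv ℝ 𝒜 (x t).1 η.1 (w t).1)) := by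
    intro η
    rfl
  have hγ' : ∀ η, trivFrame M 𝒜 (x t) (γ η)
      = fderiv ℝ (trivFrame M 𝒜) (x t) (trivFrame M 𝒜 (x t) (w t)) η
        - fderiv ℝ (trivFrame M 𝒜) (x t) (trivFrame M 𝒜 (x t) η) (w t) := by
    intro η
    rw [hγ, hDX, hDX]
    simp only [trivFrame_apply, hM1, map_zero, sub_zero, chartBracket, Prod.mk_sub_mk]
    congr 1
    abel
  rw [eulerLagrangeAt_iff_hamel hΛ hx hX hunit hw hγ', hasDerivAt_clm_iff b]
  have hpos : fderiv ℝ (fun z => Λ z (trivFrame M 𝒜 z (w t))) (x t)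
      = (fderiv ℝ (fun y => l y (w t)) (x t).1).comp (.fst ℝ Y V) := by
    rw [EventuallyEq.fderiv_eq (hl.mono fun z hz => hz _)]
    exact (hld.hasFDerivAt.comp (x t) (g := fun y => l y (w t)) hasFDerivAt_fst).fderiv
  have hlt : (fun w => Λ (x t) (trivFrame M 𝒜 (x t) w)) = l (x t).1 := funext hl.self_of_nhds
  refine forall_congr' fun i => ?_
  rw [hpos, hlt]
  have hev : (fun s => fderiv ℝ (fun w => Λ (x s) (trivFrame M 𝒜 (x s) w)) (w s) (b i)) =ᶠ[𝓝 t]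
      fun s => fderiv ℝ (l (x s).1) (w s) (b i) := by
    filter_upwards [hxt.continuousAt.eventually hl] with s hs
    rw [show (fun w => Λ (x s) (trivFrame M 𝒜 (x s) w)) = l (x s).1 from funext hs]
  rw [hev.hasDerivAt_iff]
  simp [hγ, hM1]

end Trivialized

/-! ### Parametrizations of a manifold -/

section Charts

variable {E : Type*} [NormedAddCommGroup E] [NormedSpace ℝ E]
  {E' : Type*} [NormedAddCommGroup E'] [NormedSpace ℝ E']
  {EQ : Type*} [NormedAddCommGroup EQ] [NormedSpace ℝ EQ]
  {Q : Type*} [TopologicalSpace Q] [ChartedSpace EQ Q]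

/-- The tangent vector `Tρ(x, v)` of `Q` with coordinates `(x, v)` in a parametrization `ρ`. -/
def paramVelocity (ρ : E → Q) (x v : E) : TangentBundle 𝓘(ℝ, EQ) Q :=
  tangentMap 𝓘(ℝ, E) 𝓘(ℝ, EQ) ρ ⟨x, v⟩

theorem paramVelocity_congr {ρ ρ' : E → Q} {x : E} (h : ρ =ᶠ[𝓝 x] ρ') (v : E) :
    paramVelocity (EQ := EQ) ρ x v = paramVelocity ρ' x v := by
  unfold paramVelocity tangentMap
  refine Bundle.TotalSpace.ext h.eq_of_nhds (heq_of_eq ?_)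
  exact DFunLike.congr_fun (F := E →L[ℝ] EQ) (h.mfderiv_eq (I := 𝓘(ℝ, E)) (I' := 𝓘(ℝ, EQ))) v

theorem paramVelocity_comp {ρ : E' → Q} {Ψ : E → E'} {x : E}
    (hρ : MDifferentiableAt 𝓘(ℝ, E') 𝓘(ℝ, EQ) ρ (Ψ x)) (hΨ : DifferentiableAt ℝ Ψ x) (v : E) :
    paramVelocity (EQ := EQ) (fun z => ρ (Ψ z)) x v = paramVelocity ρ (Ψ x) (fderiv ℝ Ψ x v) := by
  have := tangentMap_comp_at (I := 𝓘(ℝ, E)) (I' := 𝓘(ℝ, E')) (I'' := 𝓘(ℝ, EQ)) (g := ρ) (f := Ψ)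
    ⟨x, v⟩ hρ hΨ.mdifferentiableAt
  refine this.trans ?_
  unfold paramVelocity
  congr 1
  simp only [tangentMap, mfderiv_eq_fderiv]
  rfl

theorem contMDiff_totalSpaceMk (E : Type*) [NormedAddCommGroup E] [NormedSpace ℝ E] :
    ContMDiff 𝓘(ℝ, E × E) 𝓘(ℝ, E).tangent ∞
      (fun p : E × E => (⟨p.1, p.2⟩ : TangentBundle 𝓘(ℝ, E) E)) := by
  intro p
  rw [Bundle.contMDiffAt_totalSpace]
  refine ⟨contDiff_fst.contMDiff.contMDiffAt, ?_⟩
  have h2 := contDiff_snd.contMDiff.contMDiffAt (I := 𝓘(ℝ, E × E)) (x := p) (n := ∞)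
    (f := (Prod.snd : E × E → E))
  refine h2.congr_of_eventuallyEq (Eventually.of_forall fun q => ?_)
  simp

/-- The coordinate expression of a Lagrangian in a parametrization. -/
def paramLagrangian (L : TangentBundle 𝓘(ℝ, EQ) Q → ℝ) (ρ : E → Q) (x v : E) : ℝ :=
  L (paramVelocity ρ x v)

/-- The coordinate expression of a force field in a parametrization. -/
def paramForce {m : ℕ} (F : ControlForce (EQ := EQ) Q m) (ρ : E → Q) (x v : E) (u : Fin m → ℝ) :
    E →L[ℝ] ℝ :=
  (F (paramVelocity ρ x v) u : EQ →L[ℝ] ℝ).comp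
    (mfderiv 𝓘(ℝ, E) 𝓘(ℝ, EQ) ρ x : E →L[ℝ] EQ)

theorem force_congr {m : ℕ} (F : ControlForce (EQ := EQ) Q m) {p p' : TangentBundle 𝓘(ℝ, EQ) Q}
    (h : p = p') (u : Fin m → ℝ) (w : TangentSpace 𝓘(ℝ, EQ) p.1) (w' : TangentSpace 𝓘(ℝ, EQ) p'.1)
    (hw : (⟨p.1, w⟩ : TangentBundle 𝓘(ℝ, EQ) Q) = ⟨p'.1, w'⟩) : F p u w = F p' u w' := by
  subst h
  have : w = w' := by simpa using hw
  rw [this]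

variable [IsManifold 𝓘(ℝ, EQ) ∞ Q]

theorem contMDiffOn_paramVelocity {ρ : E → Q} {U : Set E} (hU : IsOpen U)
    (hρ : ContMDiffOn 𝓘(ℝ, E) 𝓘(ℝ, EQ) ∞ ρ U) :
    ContMDiffOn 𝓘(ℝ, E × E) 𝓘(ℝ, EQ).tangent ∞
      (fun p : E × E => paramVelocity (EQ := EQ) ρ p.1 p.2) (U ×ˢ Set.univ) := by
  have : IsManifold 𝓘(ℝ, EQ) 1 Q := IsManifold.of_le (n := ∞) (by simp)
  have h := hρ.contMDiffOn_tangentMapWithin (m := ∞) (by simp) hU.uniqueMDiffOn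
  have h2 := h.comp ((contMDiff_totalSpaceMk E).contMDiffOn (s := U ×ˢ Set.univ))
    (fun p hp => hp.1)
  refine h2.congr fun p hp => ?_
  simp only [comp_apply, paramVelocity]
  unfold tangentMapWithin tangentMap
  refine Bundle.TotalSpace.ext rfl (heq_of_eq ?_)
  exact (congrArg (fun T : E →L[ℝ] EQ => T p.2)
    (mfderivWithin_of_mem_nhds (I := 𝓘(ℝ, E)) (I' := 𝓘(ℝ, EQ)) (hU.mem_nhds hp.1))).symm

theorem differentiableAt_paramLagrangian {L : TangentBundle 𝓘(ℝ, EQ) Q → ℝ}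
    (hL : ContMDiff 𝓘(ℝ, EQ).tangent 𝓘(ℝ, ℝ) 1 L) {ρ : E → Q} {U : Set E} (hU : IsOpen U)
    (hρ : ContMDiffOn 𝓘(ℝ, E) 𝓘(ℝ, EQ) ∞ ρ U) {x : E} (hx : x ∈ U) (v : E) :
    DifferentiableAt ℝ (uncurry (paramLagrangian L ρ)) (x, v) := by
  have h1 := ((contMDiffOn_paramVelocity hU hρ).of_le (n := ∞) (m := 1) (by simp)).contMDiffAt
    ((hU.prod isOpen_univ).mem_nhds (show (x, v) ∈ U ×ˢ Set.univ from ⟨hx, trivial⟩))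
  exact (hL.contMDiffAt.comp (x, v) h1).contDiffAt.differentiableAt (by simp)

end Charts

/-! ### Covariance under changes of charts -/

section Covariance

variable {E : Type*} [NormedAddCommGroup E] [NormedSpace ℝ E]
  {E' : Type*} [NormedAddCommGroup E'] [NormedSpace ℝ E']
  {EQ : Type*} [NormedAddCommGroup EQ] [NormedSpace ℝ EQ]
  {Q : Type*} [TopologicalSpace Q] [ChartedSpace EQ Q]

/-- A smooth chart of `Q` with values in a normed space that need not be the model space `EQ`. -/
structure IsSmoothChart (c : OpenPartialHomeomorph Q E) : Prop where
  contMDiffOn : ContMDiffOn 𝓘(ℝ, EQ) 𝓘(ℝ, E) ∞ c c.source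
  contMDiffOn_symm : ContMDiffOn 𝓘(ℝ, E) 𝓘(ℝ, EQ) ∞ c.symm c.target

/-- The forced Euler–Lagrange equations in a chart. -/
def ChartEulerLagrangeAt (L : TangentBundle 𝓘(ℝ, EQ) Q → ℝ) {m : ℕ}
    (F : ControlForce (EQ := EQ) Q m) (c : OpenPartialHomeomorph Q E) (q : ℝ → Q)
    (u : ℝ → Fin m → ℝ) (t : ℝ) : Prop :=
  EulerLagrangeAt (paramLagrangian L c.symm)
    (paramForce F c.symm (c (q t)) (deriv (fun r => c (q r)) t) (u t)) (fun r => c (q r)) t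

namespace IsSmoothChart

variable {c : OpenPartialHomeomorph Q E} {c' : OpenPartialHomeomorph Q E'}

theorem mdifferentiableAt_symm (hc : IsSmoothChart (EQ := EQ) c) {z : E} (hz : z ∈ c.target) :
    MDifferentiableAt 𝓘(ℝ, E) 𝓘(ℝ, EQ) c.symm z :=
  (hc.contMDiffOn_symm.contMDiffAt (c.open_target.mem_nhds hz)).mdifferentiableAt (by simp)

theorem contDiffAt_transition (hc : IsSmoothChart (EQ := EQ) c) (hc' : IsSmoothChart (EQ := EQ) c')
    {z : E} (hz : z ∈ c.target) (hz' : c.symm z ∈ c'.source) :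
    ContDiffAt ℝ ∞ (fun z => c' (c.symm z)) z :=
  ((hc'.contMDiffOn.contMDiffAt (c'.open_source.mem_nhds hz')).comp z
    (hc.contMDiffOn_symm.contMDiffAt (c.open_target.mem_nhds hz))).contDiffAt

theorem differentiableAt_comp (hc : IsSmoothChart (EQ := EQ) c) {q : ℝ → Q} {s : ℝ}
    (hq : MDifferentiableAt 𝓘(ℝ, ℝ) 𝓘(ℝ, EQ) q s) (hs : q s ∈ c.source) :
    DifferentiableAt ℝ (fun r => c (q r)) s :=
  (((hc.contMDiffOn.contMDiffAt (c.open_source.mem_nhds hs)).mdifferentiableAt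
    (by simp)).comp s hq).differentiableAt

theorem paramVelocity_transition (hc : IsSmoothChart (EQ := EQ) c)
    (hc' : IsSmoothChart (EQ := EQ) c') {z : E} (hz : z ∈ c.target) (hz' : c.symm z ∈ c'.source)
    (v : E) :
    paramVelocity (EQ := EQ) c.symm z v
      = paramVelocity c'.symm (c' (c.symm z)) (fderiv ℝ (fun z => c' (c.symm z)) z v) := by
  rw [← paramVelocity_comp (Ψ := fun z => c' (c.symm z))
    (hc'.mdifferentiableAt_symm (c'.map_source hz'))
    ((contDiffAt_transition hc hc' hz hz').differentiableAt (by simp))]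
  refine paramVelocity_congr ?_ v
  filter_upwards [(c.continuousAt_symm hz).preimage_mem_nhds (c'.open_source.mem_nhds hz')]
    with y hy
  exact (c'.left_inv hy).symm

/-- The forced Euler–Lagrange equations carry over from one chart to another. -/
theorem chartEulerLagrangeAt_of [IsManifold 𝓘(ℝ, EQ) ∞ Q]
    (hc : IsSmoothChart (EQ := EQ) c) (hc' : IsSmoothChart (EQ := EQ) c')
    {L : TangentBundle 𝓘(ℝ, EQ) Q → ℝ} (hL : ContMDiff 𝓘(ℝ, EQ).tangent 𝓘(ℝ, ℝ) 1 L) {m : ℕ}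
    {F : ControlForce (EQ := EQ) Q m} {q : ℝ → Q} {u : ℝ → Fin m → ℝ} {t : ℝ}
    (hq : ∀ᶠ s in 𝓝 t, MDifferentiableAt 𝓘(ℝ, ℝ) 𝓘(ℝ, EQ) q s)
    (hqc : q t ∈ c.source) (hqc' : q t ∈ c'.source)
    (h : ChartEulerLagrangeAt L F c' q u t) : ChartEulerLagrangeAt L F c q u t := by
  have hqt : ContinuousAt q t := hq.self_of_nhds.continuousAt
  have hsrc : ∀ᶠ s in 𝓝 t, q s ∈ c.source :=
    hqt.preimage_mem_nhds (c.open_source.mem_nhds hqc)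
  have hz : c (q t) ∈ c.target := c.map_source hqc
  have hinv : c.symm (c (q t)) = q t := c.left_inv hqc
  have hz' : c.symm (c (q t)) ∈ c'.source := by rwa [hinv]
  have hx : ∀ᶠ s in 𝓝 t, DifferentiableAt ℝ (fun r => c (q r)) s := by
    filter_upwards [hq, hsrc] with s h1 h2 using hc.differentiableAt_comp h1 h2
  have hΨ := contDiffAt_transition hc hc' hz hz'
  have hcurve : (fun s => c' (q s)) =ᶠ[𝓝 t] fun s => c' (c.symm (c (q s))) := by
    filter_upwards [hsrc] with s hs
    rw [c.left_inv hs]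
  have hvel : deriv (fun s => c' (q s)) t
      = fderiv ℝ (fun z => c' (c.symm z)) (c (q t)) (deriv (fun r => c (q r)) t) := by
    rw [hcurve.deriv_eq]
    exact ((hΨ.differentiableAt (by simp)).hasFDerivAt.comp_hasDerivAt t
      hx.self_of_nhds.hasDerivAt).deriv
  have hcq : c' (q t) = c' (c.symm (c (q t))) := by rw [hinv]
  have h1 : EulerLagrangeAt (paramLagrangian L c'.symm)
      (paramForce F c'.symm (c' (q t)) (deriv (fun r => c' (q r)) t) (u t))
      (fun s => c' (c.symm (c (q s)))) t := by
    refine EulerLagrangeAt.congr ?_ (Eventually.of_forall fun _ => rfl) hcurve h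
    exact (c'.continuousAt hqc').comp hqt
  have h2 := EulerLagrangeAt.pullback (Ψ := fun z => c' (c.symm z)) (x := fun r => c (q r))
    (Λ := paramLagrangian L c.symm) (hΨ.of_le ENat.LEInfty.out) ?_ ?_ hx h1
  · refine Eq.mp ?_ h2
    unfold ChartEulerLagrangeAt
    congr 1
    ext w
    simp only [ContinuousLinearMap.comp_apply, paramForce]
    refine (force_congr F ?_ (u t) _ _ ?_).symm
    · rw [hvel, hcq]
      exact paramVelocity_transition hc hc' hz hz' _
    · have := paramVelocity_transition hc hc' hz hz' w
      rw [← hcq] at this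
      exact this
  · filter_upwards [c'.open_target.mem_nhds (c'.map_source hz')] with y hy v
    exact differentiableAt_paramLagrangian hL c'.open_target hc'.contMDiffOn_symm hy v
  · filter_upwards [c.open_target.mem_nhds hz,
      (c.continuousAt_symm hz).preimage_mem_nhds (c'.open_source.mem_nhds hz')] with y hy hy' v
    simp only [paramLagrangian]
    rw [paramVelocity_transition hc hc' hy hy']

end IsSmoothChart

/-- The intrinsic equations are the equations in any single smooth chart. -/
theorem forcedEulerLagrangeAt_iff_chart [IsManifold 𝓘(ℝ, EQ) ∞ Q]
    {c : OpenPartialHomeomorph Q E} (hc : IsSmoothChart (EQ := EQ) c)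
    {L : TangentBundle 𝓘(ℝ, EQ) Q → ℝ} (hL : ContMDiff 𝓘(ℝ, EQ).tangent 𝓘(ℝ, ℝ) 1 L) {m : ℕ}
    {F : ControlForce (EQ := EQ) Q m} {q : ℝ → Q} {u : ℝ → Fin m → ℝ} {t : ℝ}
    (hq : ∀ᶠ s in 𝓝 t, MDifferentiableAt 𝓘(ℝ, ℝ) 𝓘(ℝ, EQ) q s) (hqc : q t ∈ c.source) :
    ForcedEulerLagrangeAt L F q u t ↔ ChartEulerLagrangeAt L F c q u t := by
  have hat : ∀ e ∈ IsManifold.maximalAtlas 𝓘(ℝ, EQ) ∞ Q, IsSmoothChart (EQ := EQ) e :=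
    fun e he => ⟨contMDiffOn_of_mem_maximalAtlas he, contMDiffOn_symm_of_mem_maximalAtlas he⟩
  constructor
  · intro h
    have he := IsManifold.chart_mem_maximalAtlas (I := 𝓘(ℝ, EQ)) (n := ∞) (q t)
    exact hc.chartEulerLagrangeAt_of (hat _ he) hL hq hqc (mem_chart_source EQ (q t))
      (h _ he (mem_chart_source EQ (q t)))
  · intro h e he hqe
    exact (hat e he).chartEulerLagrangeAt_of hc hL hq hqe hqc h

end Covariance

/-! ### The group in the chart at the identity -/

section Group

variable {EG : Type*} [NormedAddCommGroup EG] [NormedSpace ℝ EG]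
  (G : Type*) [TopologicalSpace G] [ChartedSpace EG G] [Group G]

/-- The group multiplication in the preferred chart at the identity. -/
def chartMul (x z : EG) : EG :=
  chartAt EG (1 : G) ((chartAt EG (1 : G)).symm x * (chartAt EG (1 : G)).symm z)

/-- The derivative at the identity of the left translation by `x`, in the preferred chart. -/
def leftTranslation (x : EG) : EG →L[ℝ] EG :=
  fderiv ℝ (chartMul G x) (chartAt EG (1 : G) 1)

variable [LieGroup 𝓘(ℝ, EG) ∞ G]

theorem contDiffAt_chartMul {x z : EG} (hx : x ∈ (chartAt EG (1 : G)).target)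
    (hz : z ∈ (chartAt EG (1 : G)).target)
    (h : (chartAt EG (1 : G)).symm x * (chartAt EG (1 : G)).symm z ∈ (chartAt EG (1 : G)).source) :
    ContDiffAt ℝ ∞ (uncurry (chartMul (EG := EG) G)) (x, z) := by
  have : IsManifold 𝓘(ℝ, EG) ∞ G := ContMDiffMul.toIsManifold
  set φ := chartAt EG (1 : G)
  have h1 : ContMDiffAt 𝓘(ℝ, EG × EG) 𝓘(ℝ, EG) ∞ (fun p : EG × EG => φ.symm p.1) (x, z) :=
    ContMDiffAt.comp (x, z) (g := φ.symm)
      (contMDiffOn_chart_symm.contMDiffAt (φ.open_target.mem_nhds hx))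
      contDiff_fst.contMDiff.contMDiffAt
  have h2 : ContMDiffAt 𝓘(ℝ, EG × EG) 𝓘(ℝ, EG) ∞ (fun p : EG × EG => φ.symm p.2) (x, z) :=
    ContMDiffAt.comp (x, z) (g := φ.symm)
      (contMDiffOn_chart_symm.contMDiffAt (φ.open_target.mem_nhds hz))
      contDiff_snd.contMDiff.contMDiffAt
  have h3 := ContMDiffAt.comp (x, z) (g := φ) (f := fun p : EG × EG => φ.symm p.1 * φ.symm p.2)
    (contMDiffOn_chart.contMDiffAt (φ.open_source.mem_nhds h)) (h1.mul h2)
  exact h3.contDiffAt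

theorem contDiffAt_leftTranslation {x : EG} (hx : x ∈ (chartAt EG (1 : G)).target) :
    ContDiffAt ℝ ∞ (leftTranslation (EG := EG) G) x := by
  have h1 : chartAt EG (1 : G) 1 ∈ (chartAt EG (1 : G)).target := mem_chart_target EG 1
  have h := contDiffAt_chartMul G hx h1 (by
    rw [(chartAt EG (1 : G)).left_inv (mem_chart_source EG 1), mul_one]
    exact (chartAt EG (1 : G)).map_target hx)
  exact ContDiffAt.fderiv (f := chartMul G) (g := fun _ => chartAt EG (1 : G) 1) h
    contDiffAt_const (by simp)

theorem hasFDerivAt_chartMul {x : EG} (hx : x ∈ (chartAt EG (1 : G)).target) :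
    HasFDerivAt (chartMul G x) (leftTranslation G x) (chartAt EG (1 : G) 1) := by
  have h1 : chartAt EG (1 : G) 1 ∈ (chartAt EG (1 : G)).target := mem_chart_target EG 1
  have h := contDiffAt_chartMul G hx h1 (by
    rw [(chartAt EG (1 : G)).left_inv (mem_chart_source EG 1), mul_one]
    exact (chartAt EG (1 : G)).map_target hx)
  exact (hasFDerivAt_uncurry_right (h.differentiableAt (by simp))).differentiableAt.hasFDerivAt

omit [LieGroup 𝓘(ℝ, EG) ∞ G] in
theorem leftTranslation_one (ξ : EG) :
    leftTranslation G (chartAt EG (1 : G) 1) ξ = ξ := by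
  have : chartMul G (chartAt EG (1 : G) 1) =ᶠ[𝓝 (chartAt EG (1 : G) 1)] id := by
    filter_upwards [(chartAt EG (1 : G)).open_target.mem_nhds (mem_chart_target EG 1)] with z hz
    simp [chartMul, (chartAt EG (1 : G)).right_inv hz]
  unfold leftTranslation
  rw [this.fderiv_eq, fderiv_id]
  rfl

/-- The bracket of the Lie algebra of `G` in terms of left translations in the preferred chart. -/
theorem lie_eq_chartBracket (ξ η : GroupLieAlgebra 𝓘(ℝ, EG) G) :
    (⁅ξ, η⁆ : GroupLieAlgebra 𝓘(ℝ, EG) G)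
      = chartBracket (leftTranslation G) (chartAt EG (1 : G) 1) ξ η := by
  have : IsManifold 𝓘(ℝ, EG) ∞ G := ContMDiffMul.toIsManifold
  have : IsManifold 𝓘(ℝ, EG) 1 G := IsManifold.of_le (n := ∞) (by simp)
  set φ := chartAt EG (1 : G) with hφ
  have hfield : ∀ ζ : GroupLieAlgebra 𝓘(ℝ, EG) G,
      (VectorField.mpullbackWithin 𝓘(ℝ, EG) 𝓘(ℝ, EG) (extChartAt 𝓘(ℝ, EG) (1 : G)).symm
        (mulInvariantVectorField ζ) (Set.range 𝓘(ℝ, EG)) : EG → EG) =ᶠ[𝓝 (φ 1)]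
      fun x => leftTranslation G x ζ := by
    intro ζ
    filter_upwards [φ.open_target.mem_nhds (mem_chart_target EG 1)] with x hx
    have hh : φ.symm x ∈ φ.source := φ.map_target hx
    have hL : MDifferentiableAt 𝓘(ℝ, EG) 𝓘(ℝ, EG) (fun h : G => φ.symm x * h) 1 :=
      (contMDiff_mul_left (I := 𝓘(ℝ, EG)) (n := ∞) (a := φ.symm x)).mdifferentiableAt (by simp)
    have hφd : φ.MDifferentiable 𝓘(ℝ, EG) 𝓘(ℝ, EG) := mdifferentiable_chart (1 : G)
    -- The inverse of the derivative of `φ.symm` is the derivative of `φ`.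
    have hinv : (mfderiv 𝓘(ℝ, EG) 𝓘(ℝ, EG) φ.symm x).inverse
        = mfderiv 𝓘(ℝ, EG) 𝓘(ℝ, EG) φ (φ.symm x) := by
      refine ContinuousLinearMap.inverse_eq ?_ ?_
      · have := hφd.symm_comp_deriv hh
        rw [φ.right_inv hx] at this
        exact this
      · exact hφd.comp_symm_deriv hx
    have h1 : HasMFDerivAt 𝓘(ℝ, EG) 𝓘(ℝ, EG) φ.symm (φ 1) (ContinuousLinearMap.id ℝ EG) := by
      have h := (hφd.mdifferentiableAt_symm (mem_chart_target EG 1)).hasMFDerivAt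
      have h' := mfderivWithin_range_extChartAt_symm (I := 𝓘(ℝ, EG)) (x := (1 : G))
      rw [modelWithCornersSelf_coe, Set.range_id, mfderivWithin_univ] at h'
      exact (congrArg (fun T : EG →L[ℝ] EG => HasMFDerivAt 𝓘(ℝ, EG) 𝓘(ℝ, EG) φ.symm (φ 1) T)
        h').mp h
    have hφ1 : φ.symm (φ 1) = 1 := φ.left_inv (mem_chart_source EG 1)
    have hM : HasMFDerivAt 𝓘(ℝ, EG) 𝓘(ℝ, EG) (fun z => φ (φ.symm x * φ.symm z)) (φ 1)
        ((mfderiv 𝓘(ℝ, EG) 𝓘(ℝ, EG) φ (φ.symm x) : EG →L[ℝ] EG).comp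
          ((mfderiv 𝓘(ℝ, EG) 𝓘(ℝ, EG) (fun h : G => φ.symm x * h) 1 : EG →L[ℝ] EG).comp
            (ContinuousLinearMap.id ℝ EG))) := by
      have hL1 : φ.symm x * φ.symm (φ 1) = φ.symm x := by rw [hφ1, mul_one]
      have hL' : HasMFDerivAt 𝓘(ℝ, EG) 𝓘(ℝ, EG) (fun h : G => φ.symm x * h) (φ.symm (φ 1))
          (mfderiv 𝓘(ℝ, EG) 𝓘(ℝ, EG) (fun h : G => φ.symm x * h) 1 : EG →L[ℝ] EG) := by
        rw [hφ1]
        exact hL.hasMFDerivAt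
      have hφ' : HasMFDerivAt 𝓘(ℝ, EG) 𝓘(ℝ, EG) φ (φ.symm x * φ.symm (φ 1))
          (mfderiv 𝓘(ℝ, EG) 𝓘(ℝ, EG) φ (φ.symm x) : EG →L[ℝ] EG) := by
        rw [hL1]
        exact (hφd.mdifferentiableAt hh).hasMFDerivAt
      exact HasMFDerivAt.comp (φ 1) hφ' (HasMFDerivAt.comp (φ 1) hL' h1)
    have hM' := hM.mfderiv
    rw [mfderiv_eq_fderiv] at hM'
    have e1 : VectorField.mpullbackWithin 𝓘(ℝ, EG) 𝓘(ℝ, EG) (extChartAt 𝓘(ℝ, EG) (1 : G)).symm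
        (mulInvariantVectorField ζ) (Set.range 𝓘(ℝ, EG)) x
        = (mfderiv 𝓘(ℝ, EG) 𝓘(ℝ, EG) φ.symm x).inverse
          (mfderiv 𝓘(ℝ, EG) 𝓘(ℝ, EG) (fun h : G => φ.symm x * h) 1 ζ) := by
      rw [modelWithCornersSelf_coe, Set.range_id, VectorField.mpullbackWithin_univ]
      rfl
    refine Eq.trans e1 ?_
    rw [hinv]
    exact (DFunLike.congr_fun (F := EG →L[ℝ] EG) hM' ζ).symm
  let W : GroupLieAlgebra 𝓘(ℝ, EG) G → EG → EG := fun ζ =>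
    VectorField.mpullbackWithin 𝓘(ℝ, EG) 𝓘(ℝ, EG) (extChartAt 𝓘(ℝ, EG) (1 : G)).symm
        (mulInvariantVectorField ζ) (Set.range 𝓘(ℝ, EG))
  have h0 := VectorField.mlieBracketWithin_apply (I := 𝓘(ℝ, EG)) (s := Set.univ) (x₀ := (1 : G))
    (V := mulInvariantVectorField ξ) (W := mulInvariantVectorField η)
  rw [mfderiv_extChartAt_self] at h0
  have h1 : ⁅ξ, η⁆ = (ContinuousLinearMap.id ℝ EG).inverse
      (VectorField.lieBracketWithin ℝ (W ξ) (W η)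
        ((extChartAt 𝓘(ℝ, EG) (1 : G)).symm ⁻¹' Set.univ ∩ Set.range 𝓘(ℝ, EG)) (φ 1)) := h0
  have hset : (extChartAt 𝓘(ℝ, EG) (1 : G)).symm ⁻¹' Set.univ ∩ Set.range 𝓘(ℝ, EG)
      = (Set.univ : Set EG) := by simp
  rw [h1, hset, VectorField.lieBracketWithin_univ, ContinuousLinearMap.inverse_id,
    ContinuousLinearMap.id_apply, (hfield ξ).lieBracket_vectorField_eq (hfield η)]
  have hM : DifferentiableAt ℝ (leftTranslation (EG := EG) G) (φ 1) :=
    (contDiffAt_leftTranslation G (mem_chart_target EG 1)).differentiableAt (by simp)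
  have hd : ∀ ζ d : EG, fderiv ℝ (fun x => leftTranslation G x ζ) (φ 1) d
      = fderiv ℝ (leftTranslation (EG := EG) G) (φ 1) d ζ := by
    intro ζ d
    have := hM.hasFDerivAt.clm_apply (hasFDerivAt_const ζ (φ 1))
    rw [this.fderiv]
    simp
  have key : ∀ a b : EG, VectorField.lieBracket ℝ (fun x => leftTranslation G x a)
      (fun x => leftTranslation G x b) (φ 1) = chartBracket (leftTranslation G) (φ 1) a b := by
    intro a b
    unfold VectorField.lieBracket chartBracket
    have hL1 : ∀ a : EG, leftTranslation G (φ 1) a = a := leftTranslation_one G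
    simp only [hd, hL1]
  exact key ξ η

/-- In the chart at the identity, the velocity of a translate of `g` is the left translate of the
body velocity. -/
theorem hasDerivAt_chart_translate {g : ℝ → G} {s : ℝ}
    (hg : MDifferentiableAt 𝓘(ℝ, ℝ) 𝓘(ℝ, EG) g s) {g₀ : G}
    (hs : g₀⁻¹ * g s ∈ (chartAt EG (1 : G)).source) :
    HasDerivAt (fun r => chartAt EG (1 : G) (g₀⁻¹ * g r))
      (leftTranslation G (chartAt EG (1 : G) (g₀⁻¹ * g s)) (bodyVelocity g s)) s := by
  have : IsManifold 𝓘(ℝ, EG) ∞ G := ContMDiffMul.toIsManifold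
  have : IsManifold 𝓘(ℝ, EG) 1 G := IsManifold.of_le (n := ∞) (by simp)
  set φ := chartAt EG (1 : G) with hφ
  have h1s : (1 : G) ∈ φ.source := mem_chart_source EG 1
  have hmul : MDifferentiableAt 𝓘(ℝ, EG) 𝓘(ℝ, EG) (fun h : G => (g s)⁻¹ * h) (g s) :=
    (contMDiff_mul_left (I := 𝓘(ℝ, EG)) (n := ∞) (a := (g s)⁻¹)).mdifferentiableAt (by simp)
  have hφ1 : HasMFDerivAt 𝓘(ℝ, EG) 𝓘(ℝ, EG) φ ((g s)⁻¹ * g s)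
      (ContinuousLinearMap.id ℝ EG) := by
    rw [inv_mul_cancel]
    have h := (mdifferentiableAt_extChartAt (I := 𝓘(ℝ, EG)) (x := (1 : G)) h1s).hasMFDerivAt
    rw [mfderiv_extChartAt_self] at h
    exact h
  -- `k` is the curve `g(s)⁻¹ g(r)`, which passes through the identity at `r = s`.
  have hk : HasDerivAt (fun r => φ ((g s)⁻¹ * g r)) (bodyVelocity g s) s := by
    have h := hφ1.comp s (hmul.hasMFDerivAt.comp s hg.hasMFDerivAt)
    have hd : DifferentiableAt ℝ (fun r => φ ((g s)⁻¹ * g r)) s :=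
      h.mdifferentiableAt.differentiableAt
    refine hd.hasFDerivAt.hasDerivAt.congr_deriv ?_
    exact congrArg (fun T : ℝ →L[ℝ] EG => T 1)
      ((mfderiv_eq_fderiv (f := fun r => φ ((g s)⁻¹ * g r)) (x := s)).symm.trans h.mfderiv)
  have hk1 : φ ((g s)⁻¹ * g s) = φ 1 := by rw [inv_mul_cancel]
  have hx := hasFDerivAt_chartMul (EG := EG) G (φ.map_source hs)
  rw [← hφ, ← hk1] at hx
  refine (HasFDerivAt.comp_hasDerivAt s hx hk).congr_of_eventuallyEq ?_
  have hc : ContinuousAt (fun r => (g s)⁻¹ * g r) s :=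
    hmul.continuousAt.comp hg.continuousAt
  have : ∀ᶠ r in 𝓝 s, (g s)⁻¹ * g r ∈ φ.source :=
    hc.preimage_mem_nhds (φ.open_source.mem_nhds (by rwa [inv_mul_cancel]))
  filter_upwards [this] with r hr
  simp only [comp_apply, chartMul, ← hφ]
  rw [φ.left_inv hs, φ.left_inv hr]
  congr 1
  group

end Group

/-! ### Charts from a local trivialization -/

namespace LocalTrivialization

variable {EG : Type*} [NormedAddCommGroup EG] [NormedSpace ℝ EG]
  {G : Type*} [TopologicalSpace G] [ChartedSpace EG G] [Group G]
  {EQ : Type*} [NormedAddCommGroup EQ] [NormedSpace ℝ EQ]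
  {Q : Type*} [TopologicalSpace Q] [ChartedSpace EQ Q] [MulAction G Q]
  {r : ℕ} (ψ : LocalTrivialization (EG := EG) (EQ := EQ) G Q r)

/-- The parametrization of `Q` given by a local trivialization and the preferred chart of `G` at the
identity. -/
def param (z : EuclideanSpace ℝ (Fin r) × EG) : Q :=
  ψ.toHomeo (z.1, (chartAt EG (1 : G)).symm z.2)

/-- The domain of `param`. -/
def paramSource : Set (EuclideanSpace ℝ (Fin r) × EG) :=
  ψ.base ×ˢ (chartAt EG (1 : G)).target

/-- The chart of `Q` whose inverse is `z ↦ g₀ • ψ.param z`. -/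
def chart [ContinuousConstSMul G Q] (g₀ : G) :
    OpenPartialHomeomorph Q (EuclideanSpace ℝ (Fin r) × EG) :=
  (Homeomorph.smul g₀).symm.toOpenPartialHomeomorph.trans
    (ψ.toHomeo.symm.trans ((OpenPartialHomeomorph.refl _).prod (chartAt EG (1 : G))))

theorem isOpen_base : IsOpen ψ.base := by
  have h : IsOpen ((fun y : EuclideanSpace ℝ (Fin r) => (y, (1 : G))) ⁻¹' ψ.toHomeo.source) :=
    ψ.toHomeo.open_source.preimage (by fun_prop)
  rw [ψ.source_eq] at h
  simpa [Set.preimage] using h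

theorem isOpen_paramSource : IsOpen ψ.paramSource :=
  ψ.isOpen_base.prod (chartAt EG (1 : G)).open_target

theorem contMDiffOn_param [LieGroup 𝓘(ℝ, EG) ∞ G] :
    ContMDiffOn 𝓘(ℝ, EuclideanSpace ℝ (Fin r) × EG) 𝓘(ℝ, EQ) ∞ ψ.param ψ.paramSource := by
  have : IsManifold 𝓘(ℝ, EG) ∞ G := ContMDiffMul.toIsManifold
  refine ψ.smooth_toFun.comp (t := ψ.toHomeo.source) (f := fun z :
    EuclideanSpace ℝ (Fin r) × EG => (z.1, (chartAt EG (1 : G)).symm z.2)) ?_ ?_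
  · refine contDiff_fst.contMDiff.contMDiffOn.prodMk ?_
    exact contMDiffOn_chart_symm.comp contDiff_snd.contMDiff.contMDiffOn fun z hz => hz.2
  · intro z hz
    rw [Set.mem_preimage, ψ.source_eq]
    exact ⟨hz.1, trivial⟩

theorem smul_toHomeo (g₀ : G) {y : EuclideanSpace ℝ (Fin r)} (hy : y ∈ ψ.base) (g : G) :
    g₀⁻¹ • ψ.toHomeo (y, g) = ψ.toHomeo (y, g₀⁻¹ * g) := (ψ.equivariant y hy _ _).symm

theorem mem_source {y : EuclideanSpace ℝ (Fin r)} (hy : y ∈ ψ.base) (g : G) :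
    (y, g) ∈ ψ.toHomeo.source := by
  rw [ψ.source_eq]
  exact ⟨hy, trivial⟩

section Chart

variable [ContinuousConstSMul G Q] (g₀ : G)

theorem chart_apply (q : Q) :
    ψ.chart g₀ q = ((ψ.toHomeo.symm (g₀⁻¹ • q)).1,
      chartAt EG (1 : G) (ψ.toHomeo.symm (g₀⁻¹ • q)).2) := rfl

theorem chart_target : (ψ.chart g₀).target = ψ.paramSource := by
  ext z
  simp [chart, paramSource, ψ.source_eq]
  tauto

theorem mem_chart_source_iff (q : Q) :
    q ∈ (ψ.chart g₀).source ↔ g₀⁻¹ • q ∈ ψ.toHomeo.target ∧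
      (ψ.toHomeo.symm (g₀⁻¹ • q)).2 ∈ (chartAt EG (1 : G)).source := by
  simp [chart]

theorem chart_toHomeo {y : EuclideanSpace ℝ (Fin r)} (hy : y ∈ ψ.base) (g : G) :
    ψ.chart g₀ (ψ.toHomeo (y, g)) = (y, chartAt EG (1 : G) (g₀⁻¹ * g)) := by
  rw [chart_apply, ψ.smul_toHomeo g₀ hy, ψ.toHomeo.left_inv (ψ.mem_source hy _)]

theorem toHomeo_mem_chart_source {y : EuclideanSpace ℝ (Fin r)} (hy : y ∈ ψ.base) {g : G}
    (hg : g₀⁻¹ * g ∈ (chartAt EG (1 : G)).source) : ψ.toHomeo (y, g) ∈ (ψ.chart g₀).source := by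
  rw [mem_chart_source_iff, ψ.smul_toHomeo g₀ hy, ψ.toHomeo.left_inv (ψ.mem_source hy _)]
  exact ⟨ψ.toHomeo.map_source (ψ.mem_source hy _), hg⟩

theorem isSmoothChart_chart [LieGroup 𝓘(ℝ, EG) ∞ G]
    [ContMDiffSMul 𝓘(ℝ, EG) 𝓘(ℝ, EQ) ∞ G Q] : IsSmoothChart (EQ := EQ) (ψ.chart g₀) := by
  have : IsManifold 𝓘(ℝ, EG) ∞ G := ContMDiffMul.toIsManifold
  have hsmul : ∀ a : G, ContMDiff 𝓘(ℝ, EQ) 𝓘(ℝ, EQ) ∞ (fun q : Q => a • q) := fun a =>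
    (contMDiff_smul (I := 𝓘(ℝ, EG)) (I' := 𝓘(ℝ, EQ))).comp (contMDiff_const.prodMk contMDiff_id)
  refine ⟨?_, ?_⟩
  · have h1 : ContMDiffOn 𝓘(ℝ, EQ) (𝓘(ℝ, EuclideanSpace ℝ (Fin r)).prod 𝓘(ℝ, EG)) ∞
        (fun q => ψ.toHomeo.symm (g₀⁻¹ • q)) (ψ.chart g₀).source :=
      ψ.smooth_invFun.comp (hsmul g₀⁻¹).contMDiffOn
        fun q hq => ((ψ.mem_chart_source_iff g₀ q).1 hq).1
    refine ContMDiffOn.prodMk_space (contMDiff_fst.comp_contMDiffOn h1) ?_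
    exact contMDiffOn_chart.comp (contMDiff_snd.comp_contMDiffOn h1)
      fun q hq => ((ψ.mem_chart_source_iff g₀ q).1 hq).2
  · rw [chart_target]
    exact (hsmul g₀).comp_contMDiffOn ψ.contMDiffOn_param

end Chart

end LocalTrivialization

/-! ### Tangent vectors in a local trivialization -/

namespace LocalTrivialization

variable {EG : Type*} [NormedAddCommGroup EG] [NormedSpace ℝ EG]
  {G : Type*} [TopologicalSpace G] [ChartedSpace EG G] [Group G]
  {EQ : Type*} [NormedAddCommGroup EQ] [NormedSpace ℝ EQ]
  {Q : Type*} [TopologicalSpace Q] [ChartedSpace EQ Q] [MulAction G Q]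
  {r : ℕ} (ψ : LocalTrivialization (EG := EG) (EQ := EQ) G Q r)

theorem mem_paramSource {y : EuclideanSpace ℝ (Fin r)} (hy : y ∈ ψ.base) :
    (y, chartAt EG (1 : G) 1) ∈ ψ.paramSource := ⟨hy, mem_chart_target EG 1⟩

theorem mdifferentiableAt_toHomeo {y : EuclideanSpace ℝ (Fin r)} (hy : y ∈ ψ.base) (g : G) :
    MDifferentiableAt (𝓘(ℝ, EuclideanSpace ℝ (Fin r)).prod 𝓘(ℝ, EG)) 𝓘(ℝ, EQ) ψ.toHomeo (y, g) :=
  (ψ.smooth_toFun.contMDiffAt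
    (ψ.toHomeo.open_source.mem_nhds (ψ.mem_source hy g))).mdifferentiableAt (by simp)

/-- In the parametrization `ψ.param`, tangent vectors at `(y, e)` have the components used in
`tangentVec`. -/
theorem paramVelocity_param_one [LieGroup 𝓘(ℝ, EG) ∞ G] {y : EuclideanSpace ℝ (Fin r)}
    (hy : y ∈ ψ.base) (v : EuclideanSpace ℝ (Fin r)) (ξ : GroupLieAlgebra 𝓘(ℝ, EG) G) :
    paramVelocity (EQ := EQ) ψ.param (y, chartAt EG (1 : G) 1) (v, ξ)
      = ⟨ψ.toHomeo (y, 1), ψ.tangentVec y v ξ⟩ := by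
  have h1 : (chartAt EG (1 : G)).symm (chartAt EG (1 : G) 1) = 1 :=
    (chartAt EG (1 : G)).left_inv (mem_chart_source EG 1)
  have hp : ψ.param (y, chartAt EG (1 : G) 1) = ψ.toHomeo (y, 1) := by
    unfold param
    rw [h1]
  have hd : MDifferentiableAt 𝓘(ℝ, EuclideanSpace ℝ (Fin r) × EG) 𝓘(ℝ, EQ) ψ.param
      (y, chartAt EG (1 : G) 1) :=
    (ψ.contMDiffOn_param.contMDiffAt
      (ψ.isOpen_paramSource.mem_nhds (ψ.mem_paramSource hy))).mdifferentiableAt (by simp)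
  have key : (mfderiv 𝓘(ℝ, EuclideanSpace ℝ (Fin r) × EG) 𝓘(ℝ, EQ) ψ.param
      (y, chartAt EG (1 : G) 1) : EuclideanSpace ℝ (Fin r) × EG →L[ℝ] EQ)
      = mfderiv (𝓘(ℝ, EuclideanSpace ℝ (Fin r)).prod 𝓘(ℝ, EG)) 𝓘(ℝ, EQ) ψ.toHomeo
        (y, (1 : G)) := by
    rw [hd.mfderiv, (ψ.mdifferentiableAt_toHomeo hy 1).mfderiv]
    simp only [writtenInExtChartAt, hp, mfld_simps]
    rw [Prod.map_id, Set.range_id]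
    rfl
  unfold paramVelocity tangentMap
  refine Bundle.TotalSpace.ext hp (heq_of_eq ?_)
  exact DFunLike.congr_fun (F := EuclideanSpace ℝ (Fin r) × EG →L[ℝ] EQ) key (v, ξ)

/-- Left translation in the group component, in coordinates. -/
theorem paramVelocity_leftTranslation [LieGroup 𝓘(ℝ, EG) ∞ G]
    [ContMDiffSMul 𝓘(ℝ, EG) 𝓘(ℝ, EQ) ∞ G Q] {y : EuclideanSpace ℝ (Fin r)}
    (hy : y ∈ ψ.base) {x : EG} (hx : x ∈ (chartAt EG (1 : G)).target)
    (v : EuclideanSpace ℝ (Fin r)) (ξ : EG) :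
    paramVelocity (EQ := EQ) ψ.param (y, x) (v, leftTranslation G x ξ)
      = liftAction G ((chartAt EG (1 : G)).symm x)
        (paramVelocity ψ.param (y, chartAt EG (1 : G) 1) (v, ξ)) := by
  set φ := chartAt EG (1 : G) with hφ
  have h1 : φ.symm (φ 1) = 1 := φ.left_inv (mem_chart_source EG 1)
  have hxs : φ.symm x ∈ φ.source := φ.map_target hx
  let Ψ : EuclideanSpace ℝ (Fin r) × EG → EuclideanSpace ℝ (Fin r) × EG :=
    fun z => (z.1, chartMul G x z.2)
  have hm := hasFDerivAt_chartMul (EG := EG) G hx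
  have hΨ : HasFDerivAt Ψ ((ContinuousLinearMap.fst ℝ _ _).prod
      ((leftTranslation G x).comp (.snd ℝ _ _))) (y, φ 1) :=
    hasFDerivAt_fst.prodMk (HasFDerivAt.comp (y, φ 1) (g := chartMul G x) hm hasFDerivAt_snd)
  have hΨ1 : Ψ (y, φ 1) = (y, x) := by
    simp only [Ψ, chartMul, ← hφ, h1, mul_one, φ.right_inv hx]
  have hd : ∀ z ∈ ψ.paramSource, MDifferentiableAt 𝓘(ℝ, EuclideanSpace ℝ (Fin r) × EG) 𝓘(ℝ, EQ)
      ψ.param z := fun z hz => (ψ.contMDiffOn_param.contMDiffAt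
      (ψ.isOpen_paramSource.mem_nhds hz)).mdifferentiableAt (by simp)
  have hdx := hd (y, x) ⟨hy, hx⟩
  have hsmul : MDifferentiableAt 𝓘(ℝ, EQ) 𝓘(ℝ, EQ) (fun q : Q => φ.symm x • q)
      (ψ.param (y, φ 1)) :=
    ((contMDiff_smul (I := 𝓘(ℝ, EG)) (I' := 𝓘(ℝ, EQ)) (n := ∞)).comp
      (contMDiff_const.prodMk contMDiff_id)).mdifferentiableAt (by simp)
  rw [← hΨ1] at hdx
  have e1 := paramVelocity_comp (EQ := EQ) hdx hΨ.differentiableAt (v, ξ)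
  rw [hΨ1, hΨ.fderiv] at e1
  refine Eq.trans e1.symm ?_
  refine Eq.trans (paramVelocity_congr (ρ' := fun z => φ.symm x • ψ.param z) ?_ (v, ξ)) ?_
  · have hc : ContinuousAt (fun z : EuclideanSpace ℝ (Fin r) × EG => φ.symm x * φ.symm z.2)
        (y, φ 1) := by
      have : ContinuousAt φ.symm (φ 1) := φ.continuousAt_symm (mem_chart_target EG 1)
      have hmul := (contMDiff_mul_left (I := 𝓘(ℝ, EG)) (n := ∞) (a := φ.symm x)).continuous
      exact hmul.continuousAt.comp (ContinuousAt.comp (f := Prod.snd) this continuousAt_snd)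
    have hev : ∀ᶠ z in 𝓝 (y, φ 1), φ.symm x * φ.symm z.2 ∈ φ.source := by
      refine hc.preimage_mem_nhds (φ.open_source.mem_nhds ?_)
      simpa [h1] using hxs
    filter_upwards [hev, (ψ.isOpen_base.preimage continuous_fst).mem_nhds
      (show (y, φ 1) ∈ Prod.fst ⁻¹' ψ.base from hy)] with z hz hzb
    simp only [param, Ψ, chartMul, ← hφ]
    rw [φ.left_inv hz, ψ.equivariant _ hzb]
  · exact tangentMap_comp_at (I := 𝓘(ℝ, EuclideanSpace ℝ (Fin r) × EG)) (I' := 𝓘(ℝ, EQ))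
      (I'' := 𝓘(ℝ, EQ)) (g := fun q : Q => φ.symm x • q) (f := ψ.param) ⟨(y, φ 1), (v, ξ)⟩ hsmul
      (hd _ (ψ.mem_paramSource hy))

/-- The infinitesimal generators at `(y, e)` are the vectors `(0, ξ)`. -/
theorem infinitesimalGenerator_eq_tangentVec {y : EuclideanSpace ℝ (Fin r)}
    (hy : y ∈ ψ.base) (ξ : GroupLieAlgebra 𝓘(ℝ, EG) G) :
    infinitesimalGenerator G Q (ψ.toHomeo (y, 1)) ξ = ψ.tangentVec y 0 ξ := by
  have horb : (fun g : G => g • ψ.toHomeo (y, 1)) = fun g : G => ψ.toHomeo (y, g) := by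
    funext g
    rw [← ψ.equivariant y hy, mul_one]
  have h1 : MDifferentiableAt 𝓘(ℝ, EG) (𝓘(ℝ, EuclideanSpace ℝ (Fin r)).prod 𝓘(ℝ, EG))
      (fun g : G => (y, g)) 1 := mdifferentiableAt_const.prodMk mdifferentiableAt_id
  have h2 := mfderiv_comp_apply (I := 𝓘(ℝ, EG)) (x := (1 : G)) (g := ψ.toHomeo)
    (f := fun g : G => (y, g)) (ψ.mdifferentiableAt_toHomeo hy 1) h1 ξ
  rw [mfderiv_prod_right] at h2
  unfold infinitesimalGenerator
  have h3 : (mfderiv 𝓘(ℝ, EG) 𝓘(ℝ, EQ) (fun g : G => g • ψ.toHomeo (y, 1)) 1 : EG →L[ℝ] EQ)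
      = mfderiv 𝓘(ℝ, EG) 𝓘(ℝ, EQ) (fun g : G => ψ.toHomeo (y, g)) 1 := by rw [horb]
  exact (DFunLike.congr_fun h3 ξ).trans h2

end LocalTrivialization

/-! ### The connection form in coordinates -/

section HorizontalFrame

variable {Y V : Type*} [NormedAddCommGroup Y] [NormedSpace ℝ Y]
  [NormedAddCommGroup V] [NormedSpace ℝ V]

/-- The structure equation: if the frame fields `(u, -M(x) 𝒜(y) u)` are annihilated by a one-form
`α` that restricts to the identity on vertical vectors at `z`, then `dα` of two of them is the
local curvature. -/
theorem exteriorDerivative_horizontal {M : V → V →L[ℝ] V} {𝒜 : Y → Y →L[ℝ] V} {z : Y × V}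
    {α : Y × V → Y × V →L[ℝ] V}
    (hM : DifferentiableAt ℝ M z.2) (hM1 : ∀ ξ, M z.2 ξ = ξ) (hA : DifferentiableAt ℝ 𝒜 z.1)
    (hα : DifferentiableAt ℝ α z) (hvert : ∀ ξ, α z (0, ξ) = ξ)
    (hhor : ∀ᶠ z' in 𝓝 z, ∀ u, α z' (trivFrame M 𝒜 z' (u, 0)) = 0) (v u : Y) :
    fderiv ℝ α z (v, -𝒜 z.1 v) (u, -𝒜 z.1 u) - fderiv ℝ α z (u, -𝒜 z.1 u) (v, -𝒜 z.1 v)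
      = localCurvature M 𝒜 z v u := by
  obtain ⟨hX, hDX⟩ := fderiv_trivFrame hM hA
  have hXz : ∀ u, trivFrame M 𝒜 z (u, 0) = (u, -𝒜 z.1 u) := by
    intro u
    simp [hM1]
  have key : ∀ u d, fderiv ℝ α z d (u, -𝒜 z.1 u)
      = - α z (fderiv ℝ (trivFrame M 𝒜) z d (u, 0)) := by
    intro u d
    have h1 := hα.hasFDerivAt.clm_apply
      (hX.hasFDerivAt.clm_apply (hasFDerivAt_const ((u, 0) : Y × V) z))
    have h2 : HasFDerivAt (fun z' => α z' (trivFrame M 𝒜 z' (u, 0))) (0 : Y × V →L[ℝ] V) z :=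
      (hasFDerivAt_const (0 : V) z).congr_of_eventuallyEq (hhor.mono fun z' h => h u)
    have h3 := DFunLike.congr_fun (h1.unique h2) d
    simp only [hXz] at h3
    simp at h3
    exact eq_neg_of_add_eq_zero_right h3
  rw [key, key, hDX, hDX, hvert, hvert]
  simp only [hM1, localCurvature, chartBracket]
  simp
  abel

end HorizontalFrame

namespace PrincipalConnection

variable {EG : Type*} [NormedAddCommGroup EG] [NormedSpace ℝ EG]
  {G : Type*} [TopologicalSpace G] [ChartedSpace EG G] [Group G]
  {EQ : Type*} [NormedAddCommGroup EQ] [NormedSpace ℝ EQ]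
  {Q : Type*} [TopologicalSpace Q] [ChartedSpace EQ Q] [IsManifold 𝓘(ℝ, EQ) ∞ Q] [MulAction G Q]
  (A : PrincipalConnection (EG := EG) (EQ := EQ) G Q)
  {E : Type*} [NormedAddCommGroup E] [NormedSpace ℝ E]

/-- The coordinate expression of the connection form in a parametrization. -/
def pullback (ρ : E → Q) (z : E) : E →L[ℝ] EG :=
  (A.form (ρ z) : EQ →L[ℝ] EG).comp (mfderiv 𝓘(ℝ, E) 𝓘(ℝ, EQ) ρ z : E →L[ℝ] EQ)

theorem pullback_apply (ρ : E → Q) (z w : E) :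
    A.pullback ρ z w = A.form (paramVelocity (EQ := EQ) ρ z w).1 (paramVelocity ρ z w).2 := rfl

theorem contDiffOn_pullback [FiniteDimensional ℝ E] {ρ : E → Q} {U : Set E} (hU : IsOpen U)
    (hρ : ContMDiffOn 𝓘(ℝ, E) 𝓘(ℝ, EQ) ∞ ρ U) : ContDiffOn ℝ ∞ (A.pullback ρ) U := by
  rw [contDiffOn_clm_apply]
  intro w
  have h1 := A.smooth.comp_contMDiffOn (contMDiffOn_paramVelocity hU hρ)
  have h2 : ContDiffOn ℝ ∞ (fun p : E × E => A.pullback ρ p.1 p.2) (U ×ˢ Set.univ) :=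
    h1.contDiffOn
  exact h2.comp (contDiff_id.prodMk contDiff_const).contDiffOn fun z hz => ⟨hz, trivial⟩

/-- The exterior derivative of the connection form can be computed in any parametrization. -/
theorem exteriorDerivative_eq_pullback [FiniteDimensional ℝ E] [FiniteDimensional ℝ EQ]
    {ρ : E → Q} {U : Set E} (hU : IsOpen U)
    (hρ : ContMDiffOn 𝓘(ℝ, E) 𝓘(ℝ, EQ) ∞ ρ U) {z : E} (hz : z ∈ U) {q : Q}
    {a b : E} {v w : TangentSpace 𝓘(ℝ, EQ) q}
    (hv : paramVelocity (EQ := EQ) ρ z a = ⟨q, v⟩) (hw : paramVelocity (EQ := EQ) ρ z b = ⟨q, w⟩) :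
    A.exteriorDerivative q v w
      = fderiv ℝ (A.pullback ρ) z a b - fderiv ℝ (A.pullback ρ) z b a := by
  have hM1 : IsManifold 𝓘(ℝ, EQ) 1 Q := IsManifold.of_le (n := ∞) (by simp)
  have hq : ρ z = q := congrArg Bundle.TotalSpace.proj hv
  set c := chartAt EQ q with hc
  let Ψ : E → EQ := fun z => c (ρ z)
  have hsrc : ρ z ∈ c.source := hq ▸ mem_chart_source EQ q
  have hρz : ContMDiffAt 𝓘(ℝ, E) 𝓘(ℝ, EQ) ∞ ρ z := hρ.contMDiffAt (hU.mem_nhds hz)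
  have hcz : ContMDiffAt 𝓘(ℝ, EQ) 𝓘(ℝ, EQ) ∞ c (ρ z) :=
    contMDiffOn_chart.contMDiffAt (c.open_source.mem_nhds hsrc)
  have hΨ : ContDiffAt ℝ ∞ Ψ z := (hcz.comp z hρz).contDiffAt
  have hvel : ∀ (a : E) (v : TangentSpace 𝓘(ℝ, EQ) q), paramVelocity (EQ := EQ) ρ z a = ⟨q, v⟩ →
      (mfderiv 𝓘(ℝ, EQ) 𝓘(ℝ, EQ) c q : EQ →L[ℝ] EQ) v = fderiv ℝ Ψ z a := by
    intro a v hv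
    have h1 := tangentMap_comp_at (I := 𝓘(ℝ, E)) (I' := 𝓘(ℝ, EQ)) (I'' := 𝓘(ℝ, EQ))
      (g := c) (f := ρ) ⟨z, a⟩ (hcz.mdifferentiableAt (by simp)) (hρz.mdifferentiableAt (by simp))
    have h2 : tangentMap 𝓘(ℝ, E) 𝓘(ℝ, EQ) ρ ⟨z, a⟩ = ⟨q, v⟩ := hv
    rw [h2] at h1
    have h3 := congrArg (fun p : TangentBundle 𝓘(ℝ, EQ) EQ => (p.2 : EQ)) h1
    refine Eq.trans h3.symm ?_
    exact DFunLike.congr_fun (F := E →L[ℝ] EQ) (mfderiv_eq_fderiv (f := Ψ) (x := z)) a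
  have hΨz : Ψ z ∈ c.target := c.map_source hsrc
  have hcf : DifferentiableAt ℝ (A.chartForm q) (Ψ z) :=
    ((A.contDiffOn_pullback c.open_target contMDiffOn_chart_symm).contDiffAt
      (c.open_target.mem_nhds hΨz)).differentiableAt (by simp)
  have hDΨ : DifferentiableAt ℝ (fderiv ℝ Ψ) z :=
    (hΨ.fderiv_right (m := 1) (by exact_mod_cast ENat.LEInfty.out)).differentiableAt (by simp)
  have hev : A.pullback ρ =ᶠ[𝓝 z] fun z' => (A.chartForm q (Ψ z')).comp (fderiv ℝ Ψ z') := by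
    have h1 : ∀ᶠ z' in 𝓝 z, ρ z' ∈ c.source :=
      hρz.continuousAt.preimage_mem_nhds (c.open_source.mem_nhds hsrc)
    filter_upwards [h1, h1.eventually_nhds, hU.mem_nhds hz] with z' hz' hz'' hzU
    ext w
    have hΨ' : DifferentiableAt ℝ Ψ z' := by
      have := (contMDiffOn_chart.contMDiffAt (c.open_source.mem_nhds hz') (n := ∞)
        (I := 𝓘(ℝ, EQ))).comp z' (hρ.contMDiffAt (hU.mem_nhds hzU))
      exact this.contDiffAt.differentiableAt (by simp)
    have hcs : MDifferentiableAt 𝓘(ℝ, EQ) 𝓘(ℝ, EQ) c.symm (Ψ z') :=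
      mdifferentiableAt_atlas_symm (chart_mem_atlas EQ q) (c.map_source hz')
    have h2 := paramVelocity_comp (EQ := EQ) (ρ := c.symm) hcs hΨ' w
    have h3 : paramVelocity (EQ := EQ) ρ z' w = paramVelocity c.symm (Ψ z') (fderiv ℝ Ψ z' w) := by
      rw [← h2]
      refine paramVelocity_congr ?_ w
      filter_upwards [hz''] with y hy
      exact (c.left_inv hy).symm
    exact congrArg (fun p : TangentBundle 𝓘(ℝ, EQ) Q => (A.form p.1 p.2 : EG)) h3
  have hfd : ∀ a b, fderiv ℝ (A.pullback ρ) z a b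
      = fderiv ℝ (A.chartForm q) (Ψ z) (fderiv ℝ Ψ z a) (fderiv ℝ Ψ z b)
        + A.chartForm q (Ψ z) (fderiv ℝ (fderiv ℝ Ψ) z a b) := by
    intro a b
    have h1 := (hcf.hasFDerivAt.comp z (hΨ.differentiableAt (by simp)).hasFDerivAt).clm_comp
      hDΨ.hasFDerivAt
    rw [hev.fderiv_eq]
    refine (DFunLike.congr_fun (DFunLike.congr_fun h1.fderiv a) b).trans ?_
    simp [add_comm]
  have hs : fderiv ℝ (fderiv ℝ Ψ) z a b = fderiv ℝ (fderiv ℝ Ψ) z b a :=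
    (hΨ.isSymmSndFDerivAt (by simpa using ENat.LEInfty.out)).eq _ _
  rw [hfd, hfd, hs, add_sub_add_right_eq_sub, ← hvel a v hv, ← hvel b w hw]
  have : Ψ z = c q := by simp only [Ψ, hq]
  rw [this]
  rfl

end PrincipalConnection

/-! ### Local connection form and curvature -/

namespace LocalTrivialization

variable {EG : Type*} [NormedAddCommGroup EG] [NormedSpace ℝ EG]
  {G : Type*} [TopologicalSpace G] [ChartedSpace EG G] [Group G] [LieGroup 𝓘(ℝ, EG) ∞ G]
  {EQ : Type*} [NormedAddCommGroup EQ] [NormedSpace ℝ EQ]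
  {Q : Type*} [TopologicalSpace Q] [ChartedSpace EQ Q] [IsManifold 𝓘(ℝ, EQ) ∞ Q] [MulAction G Q]
  {r : ℕ} (ψ : LocalTrivialization (EG := EG) (EQ := EQ) G Q r)
  (A : PrincipalConnection (EG := EG) (EQ := EQ) G Q)

/-- The local connection form `A_e(y)` as a continuous linear map. -/
def localConnectionL (y : EuclideanSpace ℝ (Fin r)) : EuclideanSpace ℝ (Fin r) →L[ℝ] EG :=
  (A.pullback ψ.param (y, chartAt EG (1 : G) 1)).comp (.inl ℝ _ _)

variable {y : EuclideanSpace ℝ (Fin r)}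

theorem pullback_one_apply (hy : y ∈ ψ.base) (v : EuclideanSpace ℝ (Fin r))
    (ξ : GroupLieAlgebra 𝓘(ℝ, EG) G) :
    A.pullback ψ.param (y, chartAt EG (1 : G) 1) (v, ξ)
      = A.form (ψ.toHomeo (y, 1)) (ψ.tangentVec y v ξ) :=
  congrArg (fun p : TangentBundle 𝓘(ℝ, EQ) Q => (A.form p.1 p.2 : EG))
    (ψ.paramVelocity_param_one hy v ξ)

theorem localConnectionL_apply (hy : y ∈ ψ.base) (v : EuclideanSpace ℝ (Fin r)) :
    ψ.localConnectionL A y v = ψ.localConnection A y v :=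
  ψ.pullback_one_apply A hy v 0

theorem pullback_one_vertical (hy : y ∈ ψ.base) (ξ : EG) :
    A.pullback ψ.param (y, chartAt EG (1 : G) 1) (0, ξ) = ξ := by
  have h : ∀ ζ : GroupLieAlgebra 𝓘(ℝ, EG) G,
      A.form (ψ.toHomeo (y, 1)) (ψ.tangentVec y 0 ζ) = ζ := by
    intro ζ
    rw [← ψ.infinitesimalGenerator_eq_tangentVec hy, A.generator]
  exact (ψ.pullback_one_apply A hy 0 ξ).trans (h ξ)

theorem pullback_one_eq (hy : y ∈ ψ.base) (v : EuclideanSpace ℝ (Fin r)) (ξ : EG) :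
    A.pullback ψ.param (y, chartAt EG (1 : G) 1) (v, ξ) = ψ.localConnectionL A y v + ξ := by
  have h : ((v, ξ) : EuclideanSpace ℝ (Fin r) × EG) = (v, 0) + (0, ξ) := by simp
  rw [h, map_add, ψ.pullback_one_vertical A hy]
  rfl

/-- The frame fields `(u, -M(x) A_e(y) u)` are horizontal. -/
theorem pullback_horizontal [ContMDiffSMul 𝓘(ℝ, EG) 𝓘(ℝ, EQ) ∞ G Q]
    {z : EuclideanSpace ℝ (Fin r) × EG} (hz : z ∈ ψ.paramSource) (u : EuclideanSpace ℝ (Fin r)) :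
    A.pullback ψ.param z (trivFrame (leftTranslation G) (ψ.localConnectionL A) z (u, 0)) = 0 := by
  obtain ⟨y, x⟩ := z
  have h1 := ψ.paramVelocity_leftTranslation hz.1 hz.2 u (0 - ψ.localConnectionL A y u)
  have h2 := congrArg (fun p : TangentBundle 𝓘(ℝ, EQ) Q => (A.form p.1 p.2 : EG)) h1
  refine Eq.trans h2 ?_
  refine Eq.trans (A.equivariant _ _ _) ?_
  have h3 := ψ.pullback_one_eq A hz.1 u (0 - ψ.localConnectionL A y u)
  rw [A.pullback_apply, add_sub_cancel] at h3
  exact (congrArg (adjointAction G ((chartAt EG (1 : G)).symm x)) h3).trans (map_zero _)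

theorem contDiffAt_localConnectionL [FiniteDimensional ℝ EG] (hy : y ∈ ψ.base) :
    ContDiffAt ℝ ∞ (ψ.localConnectionL A) y := by
  have h1 := (A.contDiffOn_pullback ψ.isOpen_paramSource ψ.contMDiffOn_param).contDiffAt
    (ψ.isOpen_paramSource.mem_nhds (ψ.mem_paramSource hy))
  have h2 : ContDiffAt ℝ ∞ (fun y : EuclideanSpace ℝ (Fin r) =>
      A.pullback ψ.param (y, chartAt EG (1 : G) 1)) y :=
    ContDiffAt.comp y h1 (contDiff_id.prodMk contDiff_const).contDiffAt
  exact h2.clm_comp contDiffAt_const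

omit [LieGroup 𝓘(ℝ, EG) ∞ G] in
theorem hor_tangentVec (hy : y ∈ ψ.base) (v : EuclideanSpace ℝ (Fin r)) :
    A.hor (ψ.toHomeo (y, 1)) (ψ.tangentVec y v 0)
      = ψ.tangentVec y v (-ψ.localConnection A y v) := by
  unfold PrincipalConnection.hor
  rw [show A.form (ψ.toHomeo (y, 1)) (ψ.tangentVec y v 0) = ψ.localConnection A y v from rfl,
    ψ.infinitesimalGenerator_eq_tangentVec hy]
  generalize ψ.localConnection A y v = ξ
  let T : EuclideanSpace ℝ (Fin r) × EG →L[ℝ] EQ :=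
    mfderiv (𝓘(ℝ, EuclideanSpace ℝ (Fin r)).prod 𝓘(ℝ, EG)) 𝓘(ℝ, EQ) ψ.toHomeo (y, (1 : G))
  have h : ∀ ξ : EG, T (v, 0) - T (0, ξ) = T (v, -ξ) := by
    intro ξ
    rw [← map_sub]
    simp
  exact h ξ

/-- The curvature at `(y, e)` in the trivialization. -/
theorem curvature_eq_localCurvature [FiniteDimensional ℝ EG] [FiniteDimensional ℝ EQ]
    [ContMDiffSMul 𝓘(ℝ, EG) 𝓘(ℝ, EQ) ∞ G Q] (hy : y ∈ ψ.base)
    (v u : EuclideanSpace ℝ (Fin r)) :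
    A.curvature (ψ.toHomeo (y, 1)) (ψ.tangentVec y v 0) (ψ.tangentVec y u 0)
      = localCurvature (leftTranslation G) (ψ.localConnectionL A)
          (y, chartAt EG (1 : G) 1) v u := by
  unfold PrincipalConnection.curvature
  rw [ψ.hor_tangentVec A hy, ψ.hor_tangentVec A hy]
  have hmem := ψ.isOpen_paramSource.mem_nhds (ψ.mem_paramSource hy)
  refine (A.exteriorDerivative_eq_pullback ψ.isOpen_paramSource ψ.contMDiffOn_param
    (ψ.mem_paramSource hy) (ψ.paramVelocity_param_one hy v _)
    (ψ.paramVelocity_param_one hy u _)).trans ?_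
  rw [← ψ.localConnectionL_apply A hy, ← ψ.localConnectionL_apply A hy]
  refine exteriorDerivative_horizontal (z := (y, chartAt EG (1 : G) 1))
    ((contDiffAt_leftTranslation G (mem_chart_target EG 1)).differentiableAt (by simp))
    (leftTranslation_one G) ((ψ.contDiffAt_localConnectionL A hy).differentiableAt (by simp))
    (((A.contDiffOn_pullback ψ.isOpen_paramSource ψ.contMDiffOn_param).contDiffAt
      hmem).differentiableAt (by simp))
    (ψ.pullback_one_vertical A hy) ?_ v u
  filter_upwards [hmem] with z hz u using ψ.pullback_horizontal A hz u

end LocalTrivialization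

/-! ### Components with respect to bases -/

section Components

variable {V : Type*} [NormedAddCommGroup V] [NormedSpace ℝ V] {ι : Type*} [Fintype ι]
  (e : Module.Basis ι ℝ V) (M : V → V →L[ℝ] V) (x : V)

theorem repr_chartBracket_left (ξ η : V) (a : ι) :
    e.repr (chartBracket M x ξ η) a = ∑ d, e.repr (chartBracket M x (e d) η) a * e.repr ξ d := by
  have h : chartBracket M x ξ η = ∑ d, e.repr ξ d • chartBracket M x (e d) η := by
    conv_lhs => rw [← e.sum_repr ξ]
    unfold chartBracket
    simp only [map_sum, map_smul, sum_apply, smul_apply,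
      smul_sub, Finset.sum_sub_distrib]
  rw [h]
  simp [mul_comm]

theorem chartBracket_swap (ξ η : V) : chartBracket M x ξ η = -chartBracket M x η ξ := by
  simp [chartBracket]

theorem repr_chartBracket (ξ η : V) (a : ι) :
    e.repr (chartBracket M x ξ η) a
      = ∑ d, ∑ b, e.repr (chartBracket M x (e d) (e b)) a * e.repr ξ d * e.repr η b := by
  rw [repr_chartBracket_left]
  refine Finset.sum_congr rfl fun d _ => ?_
  rw [chartBracket_swap, map_neg, Finsupp.neg_apply, repr_chartBracket_left,
    ← Finset.sum_neg_distrib, Finset.sum_mul]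
  refine Finset.sum_congr rfl fun b _ => ?_
  rw [chartBracket_swap M x (e d) (e b), map_neg, Finsupp.neg_apply]
  ring

omit [Fintype ι] in
theorem repr_localCurvature {r : ℕ}
    (𝒜 : EuclideanSpace ℝ (Fin r) → EuclideanSpace ℝ (Fin r) →L[ℝ] V)
    (z : EuclideanSpace ℝ (Fin r) × V) (v u : EuclideanSpace ℝ (Fin r)) (a : ι) :
    e.repr (localCurvature M 𝒜 z v u) a
      = ∑ β, e.repr (localCurvature M 𝒜 z (EuclideanSpace.single β 1) u) a * v β := by
  have hv : v = ∑ β, v β • EuclideanSpace.single β (1 : ℝ) := by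
    ext i
    simp [Finset.sum_apply, Pi.single_apply]
  have h : localCurvature M 𝒜 z v u
      = ∑ β, v β • localCurvature M 𝒜 z (EuclideanSpace.single β 1) u := by
    conv_lhs => rw [hv]
    unfold localCurvature chartBracket
    simp only [map_sum, map_smul, sum_apply, smul_apply,
      smul_sub, Finset.sum_sub_distrib]
  rw [h]
  simp [mul_comm]

theorem clm_inr_eq_sum {Y : Type*} [NormedAddCommGroup Y] [NormedSpace ℝ Y]
    (T : Y × V →L[ℝ] ℝ) (ζ : V) : T (0, ζ) = ∑ a, T (0, e a) * e.repr ζ a := by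
  have h : T (0, ζ) = T.comp (.inr ℝ Y V) ζ := rfl
  rw [h, ← e.sum_repr ζ, map_sum]
  simp [mul_comm]

theorem hasDerivAt_iff_differentiableAt_and {p : ℝ → ℝ} {D : ℝ} {t : ℝ} :
    HasDerivAt p D t ↔ DifferentiableAt ℝ p t ∧ deriv p t = D :=
  ⟨fun h => ⟨h.differentiableAt, h.deriv⟩, fun h => h.2 ▸ h.1.hasDerivAt⟩

end Components

/-! ### The reduced Lagrangian and the reduced force -/

namespace LocalTrivialization

variable {EG : Type*} [NormedAddCommGroup EG] [NormedSpace ℝ EG] [FiniteDimensional ℝ EG]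
  {G : Type*} [TopologicalSpace G] [ChartedSpace EG G] [Group G] [LieGroup 𝓘(ℝ, EG) ∞ G]
  {EQ : Type*} [NormedAddCommGroup EQ] [NormedSpace ℝ EQ]
  {Q : Type*} [TopologicalSpace Q] [ChartedSpace EQ Q] [IsManifold 𝓘(ℝ, EQ) ∞ Q]
  [MulAction G Q] [ContMDiffSMul 𝓘(ℝ, EG) 𝓘(ℝ, EQ) ∞ G Q]
  {r m : ℕ} (ψ : LocalTrivialization (EG := EG) (EQ := EQ) G Q r)
  (A : PrincipalConnection (EG := EG) (EQ := EQ) G Q)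
  {L : TangentBundle 𝓘(ℝ, EQ) Q → ℝ}

variable (L) in
/-- The reduced Lagrangian as a function of the position and the velocity `(ẏ, Ω)`. -/
def reducedFun (y : EuclideanSpace ℝ (Fin r)) (w : EuclideanSpace ℝ (Fin r) × EG) : ℝ :=
  ψ.reducedLagrangian A L y w.1 w.2

omit [FiniteDimensional ℝ EG] [ContMDiffSMul 𝓘(ℝ, EG) 𝓘(ℝ, EQ) ∞ G Q] in
theorem paramVelocity_one_reducedPoint {y : EuclideanSpace ℝ (Fin r)} (hy : y ∈ ψ.base)
    (w : EuclideanSpace ℝ (Fin r) × EG) :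
    paramVelocity (EQ := EQ) ψ.param (y, chartAt EG (1 : G) 1)
      (w.1, w.2 - ψ.localConnectionL A y w.1) = ψ.reducedPoint A y w.1 w.2 := by
  refine (ψ.paramVelocity_param_one hy _ _).trans ?_
  rw [ψ.localConnectionL_apply A hy]
  rfl

omit [FiniteDimensional ℝ EG] in
/-- Invariance of the Lagrangian: in the frame `trivFrame`, it does not depend on the group
component. -/
theorem paramLagrangian_trivFrame (hLinv : InvariantLagrangian G L)
    {z : EuclideanSpace ℝ (Fin r) × EG} (hz : z ∈ ψ.paramSource)
    (w : EuclideanSpace ℝ (Fin r) × EG) :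
    paramLagrangian L ψ.param z (trivFrame (leftTranslation G) (ψ.localConnectionL A) z w)
      = ψ.reducedFun A L z.1 w := by
  obtain ⟨y, x⟩ := z
  unfold paramLagrangian
  rw [trivFrame_apply, ψ.paramVelocity_leftTranslation hz.1 hz.2, hLinv,
    ψ.paramVelocity_one_reducedPoint A hz.1]
  rfl

omit [ContMDiffSMul 𝓘(ℝ, EG) 𝓘(ℝ, EQ) ∞ G Q] in
theorem differentiableAt_frame {z : EuclideanSpace ℝ (Fin r) × EG} (hz : z ∈ ψ.paramSource) :
    DifferentiableAt ℝ (leftTranslation (EG := EG) G) z.2 ∧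
      DifferentiableAt ℝ (ψ.localConnectionL A) z.1 :=
  ⟨(contDiffAt_leftTranslation G hz.2).differentiableAt (by simp),
    (ψ.contDiffAt_localConnectionL A hz.1).differentiableAt (by simp)⟩

/-- The reduced Lagrangian is differentiable in the position. -/
theorem differentiableAt_reducedFun_left (hL : ContMDiff 𝓘(ℝ, EQ).tangent 𝓘(ℝ, ℝ) 1 L)
    (hLinv : InvariantLagrangian G L)
    {y : EuclideanSpace ℝ (Fin r)} (hy : y ∈ ψ.base) (w : EuclideanSpace ℝ (Fin r) × EG) :
    DifferentiableAt ℝ (fun y => ψ.reducedFun A L y w) y := by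
  have hz := ψ.mem_paramSource hy
  obtain ⟨hM, hA⟩ := ψ.differentiableAt_frame A hz
  have h1 := hasFDerivAt_comp_frame (Λ := paramLagrangian L ψ.param) (Ψ := id) (w := w)
    (differentiableAt_paramLagrangian hL ψ.isOpen_paramSource ψ.contMDiffOn_param hz _)
    differentiableAt_id (fderiv_trivFrame hM hA).1
  have h2 : HasFDerivAt (fun y : EuclideanSpace ℝ (Fin r) => (y, chartAt EG (1 : G) 1))
      (.inl ℝ (EuclideanSpace ℝ (Fin r)) EG) y := hasFDerivAt_prodMk_left y _
  refine (DifferentiableAt.comp y h1.differentiableAt h2.differentiableAt).congr_of_eventuallyEq ?_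
  filter_upwards [ψ.isOpen_base.mem_nhds hy] with y' hy'
  exact (ψ.paramLagrangian_trivFrame A hLinv (ψ.mem_paramSource hy') w).symm

omit [FiniteDimensional ℝ EG] in
/-- The reduced Lagrangian is differentiable in the velocity. -/
theorem differentiableAt_reducedFun (hL : ContMDiff 𝓘(ℝ, EQ).tangent 𝓘(ℝ, ℝ) 1 L)
    (hLinv : InvariantLagrangian G L)
    {y : EuclideanSpace ℝ (Fin r)} (hy : y ∈ ψ.base) (w : EuclideanSpace ℝ (Fin r) × EG) :
    DifferentiableAt ℝ (ψ.reducedFun A L y) w := by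
  have hz := ψ.mem_paramSource hy
  have h1 := (hasFDerivAt_uncurry_right (differentiableAt_paramLagrangian hL ψ.isOpen_paramSource
    ψ.contMDiffOn_param hz
    (trivFrame (leftTranslation G) (ψ.localConnectionL A) (y, chartAt EG (1 : G) 1) w))
    ).differentiableAt
  have h2 := h1.comp w
    (trivFrame (leftTranslation G) (ψ.localConnectionL A) (y, chartAt EG (1 : G) 1)
    ).differentiableAt
  refine h2.congr_of_eventuallyEq (Eventually.of_forall fun w' => ?_)
  exact (ψ.paramLagrangian_trivFrame A hLinv hz w').symm

omit [FiniteDimensional ℝ EG] [IsManifold 𝓘(ℝ, EQ) ∞ Q] in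
theorem paramVelocity_chart_symm [ContinuousConstSMul G Q] (g₀ : G)
    {z : EuclideanSpace ℝ (Fin r) × EG} (hz : z ∈ ψ.paramSource)
    (d : EuclideanSpace ℝ (Fin r) × EG) :
    paramVelocity (EQ := EQ) (ψ.chart g₀).symm z d
      = liftAction G g₀ (paramVelocity ψ.param z d) := by
  have hd : MDifferentiableAt 𝓘(ℝ, EuclideanSpace ℝ (Fin r) × EG) 𝓘(ℝ, EQ) ψ.param z :=
    (ψ.contMDiffOn_param.contMDiffAt (ψ.isOpen_paramSource.mem_nhds hz)).mdifferentiableAt (by simp)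
  have hsmul : MDifferentiableAt 𝓘(ℝ, EQ) 𝓘(ℝ, EQ) (fun q : Q => g₀ • q) (ψ.param z) :=
    ((contMDiff_smul (I := 𝓘(ℝ, EG)) (I' := 𝓘(ℝ, EQ)) (n := ∞)).comp
      (contMDiff_const.prodMk contMDiff_id)).mdifferentiableAt (by simp)
  exact tangentMap_comp_at (I := 𝓘(ℝ, EuclideanSpace ℝ (Fin r) × EG)) (I' := 𝓘(ℝ, EQ))
      (I'' := 𝓘(ℝ, EQ)) (g := fun q : Q => g₀ • q) (f := ψ.param) ⟨z, d⟩ hsmul hd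

omit [FiniteDimensional ℝ EG] in
/-- By equivariance, the force in the chart `ψ.chart g₀` is the force at the identity. -/
theorem paramForce_chart_symm [ContinuousConstSMul G Q] {F : ControlForce (EQ := EQ) Q m}
    (hF : EquivariantForce G F) (g₀ : G) {y : EuclideanSpace ℝ (Fin r)} (hy : y ∈ ψ.base)
    (w : EuclideanSpace ℝ (Fin r) × EG) (u : Fin m → ℝ) (d : EuclideanSpace ℝ (Fin r) × EG) :
    paramForce F (ψ.chart g₀).symm (y, chartAt EG (1 : G) 1)
        (w.1, w.2 - ψ.localConnectionL A y w.1) u d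
      = F (ψ.reducedPoint A y w.1 w.2) u (ψ.tangentVec y d.1 d.2) := by
  have hz := ψ.mem_paramSource hy
  have hcomp := ψ.paramVelocity_chart_symm g₀ hz
  refine Eq.trans ?_ (hF g₀ (ψ.reducedPoint A y w.1 w.2) u (ψ.tangentVec y d.1 d.2))
  refine force_congr F ?_ u _ _ ?_
  · rw [hcomp, ψ.paramVelocity_one_reducedPoint A hy]
  · exact (hcomp d).trans
      (congrArg (liftAction G g₀) (ψ.paramVelocity_param_one hy d.1 d.2))

end LocalTrivialization

/-! ### The equations in the trivializing frame -/

namespace LocalTrivialization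

variable {EG : Type*} [NormedAddCommGroup EG] [NormedSpace ℝ EG] [FiniteDimensional ℝ EG]
  {G : Type*} [TopologicalSpace G] [ChartedSpace EG G] [Group G] [LieGroup 𝓘(ℝ, EG) ∞ G]
  {EQ : Type*} [NormedAddCommGroup EQ] [NormedSpace ℝ EQ]
  {Q : Type*} [TopologicalSpace Q] [ChartedSpace EQ Q] [IsManifold 𝓘(ℝ, EQ) ∞ Q]
  [MulAction G Q] [ContMDiffSMul 𝓘(ℝ, EG) 𝓘(ℝ, EQ) ∞ G Q]
  {r m : ℕ} (ψ : LocalTrivialization (EG := EG) (EQ := EQ) G Q r)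
  (A : PrincipalConnection (EG := EG) (EQ := EQ) G Q)
  {L : TangentBundle 𝓘(ℝ, EQ) Q → ℝ} {F : ControlForce (EQ := EQ) Q m}
  {y : ℝ → EuclideanSpace ℝ (Fin r)} {g : ℝ → G} {u : ℝ → Fin m → ℝ} {t : ℝ}

/-- The velocity `(ẏ, Ω)` of a curve with respect to the frame `trivFrame`. -/
def frameVelocity (y : ℝ → EuclideanSpace ℝ (Fin r)) (g : ℝ → G) (s : ℝ) :
    EuclideanSpace ℝ (Fin r) × EG :=
  (deriv y s, ψ.verticalVelocity A y g s)

omit [FiniteDimensional ℝ EG] [ContMDiffSMul 𝓘(ℝ, EG) 𝓘(ℝ, EQ) ∞ G Q] in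
theorem frameVelocity_snd_sub {s : ℝ} (hys : y s ∈ ψ.base) :
    (ψ.frameVelocity A y g s).2 - ψ.localConnectionL A (y s) (ψ.frameVelocity A y g s).1
      = bodyVelocity g s := by
  rw [show (ψ.frameVelocity A y g s).1 = deriv y s from rfl, ψ.localConnectionL_apply A hys]
  exact add_sub_cancel_left (G := EG) _ _

/-- The forced Euler–Lagrange equations of a `G`-invariant system in a local trivialization, as one
equation for each basis vector. -/
theorem forcedEulerLagrangeAt_iff_frame
    (hL : ContMDiff 𝓘(ℝ, EQ).tangent 𝓘(ℝ, ℝ) 1 L) (hLinv : InvariantLagrangian G L)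
    (hF : EquivariantForce G F) (hyY : ∀ᶠ s in 𝓝 t, y s ∈ ψ.base)
    (hy : ∀ᶠ s in 𝓝 t, DifferentiableAt ℝ y s)
    (hg : ∀ᶠ s in 𝓝 t, MDifferentiableAt 𝓘(ℝ, ℝ) 𝓘(ℝ, EG) g s)
    {κ : Type*} [Fintype κ] (b : Module.Basis κ ℝ (EuclideanSpace ℝ (Fin r) × EG)) :
    ForcedEulerLagrangeAt L F (fun s => ψ.toHomeo (y s, g s)) u t ↔ ∀ i,
      HasDerivAt (fun s => fderiv ℝ (ψ.reducedFun A L (y s)) (ψ.frameVelocity A y g s) (b i))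
        (fderiv ℝ (fun z => ψ.reducedFun A L z (ψ.frameVelocity A y g t)) (y t) (b i).1
          + fderiv ℝ (ψ.reducedFun A L (y t)) (ψ.frameVelocity A y g t)
            (0, chartBracket (leftTranslation G) (chartAt EG (1 : G) 1)
              ((ψ.frameVelocity A y g t).2 - ψ.localConnectionL A (y t) (deriv y t))
              ((b i).2 - ψ.localConnectionL A (y t) (b i).1)
            - (fderiv ℝ (ψ.localConnectionL A) (y t) (deriv y t) (b i).1
              - fderiv ℝ (ψ.localConnectionL A) (y t) (b i).1 (deriv y t)))
          + F (ψ.reducedPoint A (y t) (deriv y t) (ψ.verticalVelocity A y g t)) (u t)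
            (ψ.tangentVec (y t) (b i).1 ((b i).2 - ψ.localConnectionL A (y t) (b i).1))) t := by
  have hcs : ContinuousConstSMul G Q := ⟨fun a =>
    ((contMDiff_smul (I := 𝓘(ℝ, EG)) (I' := 𝓘(ℝ, EQ)) (n := ∞)).comp
      (contMDiff_const.prodMk contMDiff_id)).continuous⟩
  have hyt := hyY.self_of_nhds
  set φ := chartAt EG (1 : G) with hφ
  have hone : (g t)⁻¹ * g t ∈ φ.source := by
    rw [inv_mul_cancel]
    exact mem_chart_source EG 1
  have hq : ∀ᶠ s in 𝓝 t, MDifferentiableAt 𝓘(ℝ, ℝ) 𝓘(ℝ, EQ) (fun s => ψ.toHomeo (y s, g s)) s := by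
    filter_upwards [hyY, hy, hg] with s h1 h2 h3
    exact (ψ.mdifferentiableAt_toHomeo h1 (g s)).comp s (h2.mdifferentiableAt.prodMk h3)
  rw [forcedEulerLagrangeAt_iff_chart (ψ.isSmoothChart_chart (g t)) hL hq
    (ψ.toHomeo_mem_chart_source (g t) hyt hone)]
  -- The curve in the chart, which passes through the identity of the group at time `t`.
  let x : ℝ → EuclideanSpace ℝ (Fin r) × EG := fun s => (y s, φ ((g t)⁻¹ * g s))
  have hxt : x t = (y t, φ 1) := by simp only [x, inv_mul_cancel]
  have hcx : (fun s => ψ.chart (g t) (ψ.toHomeo (y s, g s))) =ᶠ[𝓝 t] x := by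
    filter_upwards [hyY] with s hs using ψ.chart_toHomeo (g t) hs (g s)
  have hsrc : ∀ᶠ s in 𝓝 t, (g t)⁻¹ * g s ∈ φ.source := by
    have hmul := (contMDiff_mul_left (I := 𝓘(ℝ, EG)) (n := ∞) (a := (g t)⁻¹)).continuous
    exact (hmul.continuousAt.comp hg.self_of_nhds.continuousAt).preimage_mem_nhds
      (φ.open_source.mem_nhds hone)
  have hxd : ∀ᶠ s in 𝓝 t, HasDerivAt x
      (trivFrame (leftTranslation G) (ψ.localConnectionL A) (x s) (ψ.frameVelocity A y g s)) s := by
    filter_upwards [hyY, hy, hg, hsrc] with s h1 h2 h3 h4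
    rw [trivFrame_apply, ψ.frameVelocity_snd_sub A h1]
    exact h2.hasDerivAt.prodMk (hasDerivAt_chart_translate G h3 h4)
  have hxc : ContinuousAt x t := hxd.self_of_nhds.continuousAt
  have hmem : x t ∈ ψ.paramSource := by
    rw [hxt]
    exact ψ.mem_paramSource hyt
  have hsrcx := ψ.isOpen_paramSource.mem_nhds hmem
  have hinv : ∀ᶠ z in 𝓝 (x t),
      paramLagrangian L (ψ.chart (g t)).symm z = paramLagrangian L ψ.param z := by
    filter_upwards [hsrcx] with z hz
    funext d
    unfold paramLagrangian
    rw [ψ.paramVelocity_chart_symm _ hz, hLinv]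
  set f := paramForce F (ψ.chart (g t)).symm (ψ.chart (g t) (ψ.toHomeo (y t, g t)))
    (deriv (fun r => ψ.chart (g t) (ψ.toHomeo (y r, g r))) t) (u t) with hf
  have hforce : ∀ d, f d = F (ψ.reducedPoint A (y t) (deriv y t) (ψ.verticalVelocity A y g t)) (u t)
            (ψ.tangentVec (y t) d.1 d.2) := by
    intro d
    rw [hf, hcx.deriv_eq, hcx.eq_of_nhds, hxd.self_of_nhds.deriv, hxt, trivFrame_apply,
      leftTranslation_one]
    exact ψ.paramForce_chart_symm A hF (g t) hyt (ψ.frameVelocity A y g t) (u t) d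
  have hchart : ChartEulerLagrangeAt L F (ψ.chart (g t)) (fun s => ψ.toHomeo (y s, g s)) u t
      ↔ EulerLagrangeAt (paramLagrangian L ψ.param) f x t := by
    have hcc : ContinuousAt (fun s => ψ.chart (g t) (ψ.toHomeo (y s, g s))) t :=
      hxc.congr_of_eventuallyEq hcx
    constructor
    · intro h
      refine EulerLagrangeAt.congr hcc ?_ hcx h
      rw [hcx.eq_of_nhds]
      exact hinv
    · intro h
      exact EulerLagrangeAt.congr hxc (hinv.mono fun z hz => hz.symm) hcx.symm h
  obtain ⟨hM, hA⟩ := ψ.differentiableAt_frame A hmem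
  rw [hchart, eulerLagrangeAt_iff_trivialized (l := ψ.reducedFun A L)
    (w := ψ.frameVelocity A y g) ?_ (hxd.mono fun s h => h.differentiableAt) hM hA ?_
    (hxd.mono fun s h => h.deriv) ?_ ?_ b]
  · refine forall_congr' fun i => ?_
    rw [hforce, hxt]
    rfl
  · filter_upwards [hsrcx] with z hz v
    exact differentiableAt_paramLagrangian hL ψ.isOpen_paramSource ψ.contMDiffOn_param hz v
  · rw [hxt]
    exact leftTranslation_one G
  · filter_upwards [hsrcx] with z hz w using ψ.paramLagrangian_trivFrame A hLinv hz w
  · exact ψ.differentiableAt_reducedFun_left A hL hLinv hyt _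

end LocalTrivialization

/-! ### The Lagrange–Poincaré equations -/

namespace LocalTrivialization

variable {EG : Type*} [NormedAddCommGroup EG] [NormedSpace ℝ EG] [FiniteDimensional ℝ EG]
  {G : Type*} [TopologicalSpace G] [ChartedSpace EG G] [Group G] [LieGroup 𝓘(ℝ, EG) ∞ G]
  {EQ : Type*} [NormedAddCommGroup EQ] [NormedSpace ℝ EQ]
  {Q : Type*} [TopologicalSpace Q] [ChartedSpace EQ Q] [IsManifold 𝓘(ℝ, EQ) ∞ Q]
  [MulAction G Q] [ContMDiffSMul 𝓘(ℝ, EG) 𝓘(ℝ, EQ) ∞ G Q]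
  {r m : ℕ} (ψ : LocalTrivialization (EG := EG) (EQ := EQ) G Q r)
  (A : PrincipalConnection (EG := EG) (EQ := EQ) G Q)
  {L : TangentBundle 𝓘(ℝ, EQ) Q → ℝ} {F : ControlForce (EQ := EQ) Q m}
  {y : ℝ → EuclideanSpace ℝ (Fin r)} {g : ℝ → G} {u : ℝ → Fin m → ℝ} {t : ℝ}
  {ι : Type*} [Fintype ι] (e : Module.Basis ι ℝ (GroupLieAlgebra 𝓘(ℝ, EG) G))

omit [FiniteDimensional ℝ EG] [Fintype ι] in
theorem partialOmega_eq_fderiv (hL : ContMDiff 𝓘(ℝ, EQ).tangent 𝓘(ℝ, ℝ) 1 L)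
    (hLinv : InvariantLagrangian G L) {s : ℝ} (hys : y s ∈ ψ.base) (a : ι) :
    partialOmega ψ A e L y g a s
      = fderiv ℝ (ψ.reducedFun A L (y s)) (ψ.frameVelocity A y g s) (0, e a) := by
  have h1 := (ψ.differentiableAt_reducedFun A hL hLinv hys
    (ψ.frameVelocity A y g s)).hasFDerivAt.hasLineDerivAt (0, e a)
  rw [← h1.lineDeriv]
  unfold partialOmega lineDeriv
  congr 1
  funext c
  change ψ.reducedLagrangian A L (y s) (deriv y s) (ψ.verticalVelocity A y g s + c • e a)
    = ψ.reducedLagrangian A L (y s) (deriv y s + c • (0 : EuclideanSpace ℝ (Fin r)))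
      (ψ.verticalVelocity A y g s + c • e a)
  rw [smul_zero, add_zero]

omit [FiniteDimensional ℝ EG] in
theorem partialVelocity_eq_fderiv (hL : ContMDiff 𝓘(ℝ, EQ).tangent 𝓘(ℝ, ℝ) 1 L)
    (hLinv : InvariantLagrangian G L) {s : ℝ} (hys : y s ∈ ψ.base) (α : Fin r) :
    partialVelocity ψ A L y g α s
      = fderiv ℝ (ψ.reducedFun A L (y s)) (ψ.frameVelocity A y g s)
        (EuclideanSpace.single α 1, 0) := by
  have h1 := (ψ.differentiableAt_reducedFun A hL hLinv hys
    (ψ.frameVelocity A y g s)).hasFDerivAt.hasLineDerivAt (EuclideanSpace.single α 1, 0)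
  rw [← h1.lineDeriv]
  unfold partialVelocity lineDeriv
  congr 1
  funext c
  change ψ.reducedLagrangian A L (y s) (deriv y s + c • EuclideanSpace.single α 1)
      (ψ.verticalVelocity A y g s)
    = ψ.reducedLagrangian A L (y s) (deriv y s + c • EuclideanSpace.single α 1)
      (ψ.verticalVelocity A y g s + c • (0 : GroupLieAlgebra 𝓘(ℝ, EG) G))
  rw [smul_zero, add_zero]

theorem partialPosition_eq_fderiv (hL : ContMDiff 𝓘(ℝ, EQ).tangent 𝓘(ℝ, ℝ) 1 L)
    (hLinv : InvariantLagrangian G L) {s : ℝ} (hys : y s ∈ ψ.base) (α : Fin r) :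
    partialPosition ψ A L y g α s
      = fderiv ℝ (fun z => ψ.reducedFun A L z (ψ.frameVelocity A y g s)) (y s)
        (EuclideanSpace.single α 1) :=
  ((ψ.differentiableAt_reducedFun_left A hL hLinv hys
    (ψ.frameVelocity A y g s)).hasFDerivAt.hasLineDerivAt _).lineDeriv

/-- A basis of the Lie algebra as a basis of the model space, to which the Lie algebra is equal as a
vector space. -/
def modelBasis : Module.Basis ι ℝ EG := e

omit [FiniteDimensional ℝ EG] [Fintype ι] in
theorem structureConst_eq (a d b : ι) :
    structureConst e a d b = (modelBasis e).repr (chartBracket (leftTranslation G)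
      (chartAt EG (1 : G) 1) (modelBasis e d) (modelBasis e b)) a :=
  congrArg (fun ζ => e.repr ζ a) (lie_eq_chartBracket G (e d) (e b))

omit [FiniteDimensional ℝ EG] [ContMDiffSMul 𝓘(ℝ, EG) 𝓘(ℝ, EQ) ∞ G Q] [Fintype ι] in
theorem connectionCoeff_eq {z : EuclideanSpace ℝ (Fin r)} (hz : z ∈ ψ.base) (d : ι) (α : Fin r) :
    ψ.connectionCoeff A e z d α
      = (modelBasis e).repr (ψ.localConnectionL A z (EuclideanSpace.single α 1)) d :=
  congrArg (fun ζ => e.repr ζ d) (ψ.localConnectionL_apply A hz _).symm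

omit [Fintype ι] in
theorem curvatureCoeff_eq [FiniteDimensional ℝ EQ] {z : EuclideanSpace ℝ (Fin r)}
    (hz : z ∈ ψ.base) (a : ι) (β α : Fin r) :
    ψ.curvatureCoeff A e z a β α
      = (modelBasis e).repr (localCurvature (leftTranslation G) (ψ.localConnectionL A)
        (z, chartAt EG (1 : G) 1) (EuclideanSpace.single β 1) (EuclideanSpace.single α 1)) a :=
  congrArg (fun ζ => e.repr ζ a) (ψ.curvature_eq_localCurvature A hz _ _)

omit [FiniteDimensional ℝ EG] [ContMDiffSMul 𝓘(ℝ, EG) 𝓘(ℝ, EQ) ∞ G Q] [Fintype ι] in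
theorem repr_localConnectionL {z : EuclideanSpace ℝ (Fin r)}
    (hz : z ∈ ψ.base) (v : EuclideanSpace ℝ (Fin r)) (d : ι) :
    (modelBasis e).repr (ψ.localConnectionL A z v) d = ∑ α, ψ.connectionCoeff A e z d α * v α := by
  have hv : v = ∑ α, v α • EuclideanSpace.single α (1 : ℝ) := by
    ext i
    simp [Finset.sum_apply, Pi.single_apply]
  have h : ψ.localConnectionL A z v
      = ∑ α, v α • ψ.localConnectionL A z (EuclideanSpace.single α 1) := by
    conv_lhs => rw [hv]
    simp only [map_sum, map_smul]
  rw [h]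
  simp [ψ.connectionCoeff_eq A e hz, mul_comm]

omit [FiniteDimensional ℝ EG] in
theorem verticalEquationAt_iff (hL : ContMDiff 𝓘(ℝ, EQ).tangent 𝓘(ℝ, ℝ) 1 L)
    (hLinv : InvariantLagrangian G L) (hyY : ∀ᶠ s in 𝓝 t, y s ∈ ψ.base) (b : ι) :
    VerticalEquationAt ψ A e L F y g u b t ↔
      HasDerivAt (fun s => fderiv ℝ (ψ.reducedFun A L (y s)) (ψ.frameVelocity A y g s)
          (0, modelBasis e b))
        (fderiv ℝ (ψ.reducedFun A L (y t)) (ψ.frameVelocity A y g t)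
            (0, chartBracket (leftTranslation G) (chartAt EG (1 : G) 1)
              ((ψ.frameVelocity A y g t).2 - ψ.localConnectionL A (y t) (deriv y t))
              (modelBasis e b))
          + ψ.verticalForce A F (y t) (deriv y t) (ψ.verticalVelocity A y g t) (u t) (e b)) t := by
  have hyt := hyY.self_of_nhds
  have hev : partialOmega ψ A e L y g b =ᶠ[𝓝 t]
      fun s => fderiv ℝ (ψ.reducedFun A L (y s)) (ψ.frameVelocity A y g s)
          (0, modelBasis e b) := by
    filter_upwards [hyY] with s hs using ψ.partialOmega_eq_fderiv A e hL hLinv hs b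
  unfold VerticalEquationAt
  rw [← hev.hasDerivAt_iff, hasDerivAt_iff_differentiableAt_and, sub_eq_iff_eq_add',
    clm_inr_eq_sum (modelBasis e)]
  have hsum : ∀ a, (modelBasis e).repr (chartBracket (leftTranslation G) (chartAt EG (1 : G) 1)
      ((ψ.frameVelocity A y g t).2 - ψ.localConnectionL A (y t) (deriv y t))
        (modelBasis e b)) a
      = ∑ d, structureConst e a d b * e.repr (ψ.verticalVelocity A y g t) d
          - ∑ d, ∑ α, structureConst e a d b * ψ.connectionCoeff A e (y t) d α * deriv y t α := by
    intro a
    rw [repr_chartBracket_left, ← Finset.sum_sub_distrib]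
    refine Finset.sum_congr rfl fun d _ => ?_
    rw [← structureConst_eq, map_sub, Finsupp.sub_apply, ψ.repr_localConnectionL A e hyt, mul_sub,
      Finset.mul_sum]
    congr 1
    exact Finset.sum_congr rfl fun α _ => (mul_assoc _ _ _).symm
  have hsum' : ∑ a, partialOmega ψ A e L y g a t *
        (∑ d, structureConst e a d b * e.repr (ψ.verticalVelocity A y g t) d
          - ∑ d, ∑ α, structureConst e a d b * ψ.connectionCoeff A e (y t) d α * deriv y t α)
      = ∑ a, fderiv ℝ (ψ.reducedFun A L (y t)) (ψ.frameVelocity A y g t) (0, modelBasis e a)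
        * (modelBasis e).repr (chartBracket (leftTranslation G) (chartAt EG (1 : G) 1)
          ((ψ.frameVelocity A y g t).2 - ψ.localConnectionL A (y t) (deriv y t))
          (modelBasis e b)) a := by
    refine Finset.sum_congr rfl fun a _ => ?_
    rw [hsum, ψ.partialOmega_eq_fderiv A e hL hLinv hyt]
    rfl
  rw [hsum']

theorem horizontalEquationAt_iff [FiniteDimensional ℝ EQ]
    (hL : ContMDiff 𝓘(ℝ, EQ).tangent 𝓘(ℝ, ℝ) 1 L)
    (hLinv : InvariantLagrangian G L) (hyY : ∀ᶠ s in 𝓝 t, y s ∈ ψ.base) (α : Fin r) :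
    HorizontalEquationAt ψ A e L F y g u α t ↔
      HasDerivAt (fun s => fderiv ℝ (ψ.reducedFun A L (y s)) (ψ.frameVelocity A y g s)
          (EuclideanSpace.single α 1, 0))
        (fderiv ℝ (fun z => ψ.reducedFun A L z (ψ.frameVelocity A y g t)) (y t)
            (EuclideanSpace.single α 1)
          - fderiv ℝ (ψ.reducedFun A L (y t)) (ψ.frameVelocity A y g t)
            (0, localCurvature (leftTranslation G) (ψ.localConnectionL A)
                (y t, chartAt EG (1 : G) 1) (deriv y t) (EuclideanSpace.single α 1)
              + chartBracket (leftTranslation G) (chartAt EG (1 : G) 1)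
                (ψ.frameVelocity A y g t).2
                (ψ.localConnectionL A (y t) (EuclideanSpace.single α 1)))
          + ψ.horizontalForce A F (y t) (deriv y t) (ψ.verticalVelocity A y g t) (u t)
            (EuclideanSpace.single α 1)) t := by
  have hyt := hyY.self_of_nhds
  have hev : partialVelocity ψ A L y g α =ᶠ[𝓝 t]
      fun s => fderiv ℝ (ψ.reducedFun A L (y s)) (ψ.frameVelocity A y g s)
          (EuclideanSpace.single α 1, 0) := by
    filter_upwards [hyY] with s hs using ψ.partialVelocity_eq_fderiv A hL hLinv hs α
  have hsum : ∀ a, (modelBasis e).repr (localCurvature (leftTranslation G) (ψ.localConnectionL A)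
                (y t, chartAt EG (1 : G) 1) (deriv y t) (EuclideanSpace.single α 1)
              + chartBracket (leftTranslation G) (chartAt EG (1 : G) 1)
                (ψ.frameVelocity A y g t).2
                (ψ.localConnectionL A (y t) (EuclideanSpace.single α 1))) a
      = ∑ β, ψ.curvatureCoeff A e (y t) a β α * deriv y t β
          + ∑ d, ∑ b, structureConst e a d b * e.repr (ψ.verticalVelocity A y g t) d *
              ψ.connectionCoeff A e (y t) b α := by
    intro a
    rw [map_add, Finsupp.add_apply, repr_localCurvature, repr_chartBracket]
    simp only [← ψ.curvatureCoeff_eq A e hyt, ← ψ.connectionCoeff_eq A e hyt, ← structureConst_eq]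
    rfl
  have hsum' : ∑ a, partialOmega ψ A e L y g a t *
        (∑ β, ψ.curvatureCoeff A e (y t) a β α * deriv y t β
          + ∑ d, ∑ b, structureConst e a d b * e.repr (ψ.verticalVelocity A y g t) d *
              ψ.connectionCoeff A e (y t) b α)
      = fderiv ℝ (ψ.reducedFun A L (y t)) (ψ.frameVelocity A y g t)
            (0, localCurvature (leftTranslation G) (ψ.localConnectionL A)
                (y t, chartAt EG (1 : G) 1) (deriv y t) (EuclideanSpace.single α 1)
              + chartBracket (leftTranslation G) (chartAt EG (1 : G) 1)
                (ψ.frameVelocity A y g t).2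
                (ψ.localConnectionL A (y t) (EuclideanSpace.single α 1))) := by
    rw [clm_inr_eq_sum (modelBasis e)]
    refine Finset.sum_congr rfl fun a _ => ?_
    rw [hsum, ψ.partialOmega_eq_fderiv A e hL hLinv hyt]
    rfl
  unfold HorizontalEquationAt
  rw [← hev.hasDerivAt_iff, hasDerivAt_iff_differentiableAt_and, hsum',
    ψ.partialPosition_eq_fderiv A hL hLinv hyt]
  refine and_congr_right fun _ => ?_
  constructor <;> intro h <;> linarith

theorem forcedEulerLagrangeAt_iff_forcedLagrangePoincareAt [FiniteDimensional ℝ EQ]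
    (hL : ContMDiff 𝓘(ℝ, EQ).tangent 𝓘(ℝ, ℝ) 1 L) (hLinv : InvariantLagrangian G L)
    (hF : EquivariantForce G F) (hyY : ∀ᶠ s in 𝓝 t, y s ∈ ψ.base)
    (hy : ∀ᶠ s in 𝓝 t, DifferentiableAt ℝ y s)
    (hg : ∀ᶠ s in 𝓝 t, MDifferentiableAt 𝓘(ℝ, ℝ) 𝓘(ℝ, EG) g s) :
    ForcedEulerLagrangeAt L F (fun s => ψ.toHomeo (y s, g s)) u t ↔
      ForcedLagrangePoincareAt ψ A e L F y g u t := by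
  have hyt := hyY.self_of_nhds
  let b : Module.Basis (Fin r ⊕ ι) ℝ (EuclideanSpace ℝ (Fin r) × EG) :=
    (EuclideanSpace.basisFun (Fin r) ℝ).toBasis.prod (modelBasis e)
  have hbl : ∀ α, b (Sum.inl α) = (EuclideanSpace.single α 1, 0) := by
    intro α
    ext1 <;> simp [b]
  have hbr : ∀ a, b (Sum.inr a) = (0, modelBasis e a) := by
    intro a
    ext1 <;> simp [b]
  rw [ψ.forcedEulerLagrangeAt_iff_frame A hL hLinv hF hyY hy hg b, Sum.forall, and_comm]
  unfold ForcedLagrangePoincareAt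
  refine and_congr (forall_congr' fun a => ?_) (forall_congr' fun α => ?_)
  · rw [ψ.verticalEquationAt_iff A e hL hLinv hyY, hbr]
    simp only [map_zero, sub_zero, zero_apply, sub_self, zero_add]
    rfl
  · rw [ψ.horizontalEquationAt_iff A e hL hLinv hyY, hbl]
    have hbracket : chartBracket (leftTranslation G) (chartAt EG (1 : G) 1)
          ((ψ.frameVelocity A y g t).2 - ψ.localConnectionL A (y t) (deriv y t))
          (0 - ψ.localConnectionL A (y t) (EuclideanSpace.single α 1))
        - (fderiv ℝ (ψ.localConnectionL A) (y t) (deriv y t) (EuclideanSpace.single α 1)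
          - fderiv ℝ (ψ.localConnectionL A) (y t) (EuclideanSpace.single α 1) (deriv y t))
        = -(localCurvature (leftTranslation G) (ψ.localConnectionL A)
                (y t, chartAt EG (1 : G) 1) (deriv y t) (EuclideanSpace.single α 1)
              + chartBracket (leftTranslation G) (chartAt EG (1 : G) 1)
                (ψ.frameVelocity A y g t).2
                (ψ.localConnectionL A (y t) (EuclideanSpace.single α 1))) := by
      simp only [localCurvature, chartBracket, map_sub, map_zero, sub_apply, zero_apply]
      abel
    have hforce : F (ψ.reducedPoint A (y t) (deriv y t) (ψ.verticalVelocity A y g t)) (u t)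
          (ψ.tangentVec (y t) (EuclideanSpace.single α 1)
            (0 - ψ.localConnectionL A (y t) (EuclideanSpace.single α 1) : EG))
        = ψ.horizontalForce A F (y t) (deriv y t) (ψ.verticalVelocity A y g t) (u t)
            (EuclideanSpace.single α 1) :=
      congrArg (fun ζ : EG => F (ψ.reducedPoint A (y t) (deriv y t) (ψ.verticalVelocity A y g t))
          (u t) (ψ.tangentVec (y t) (EuclideanSpace.single α 1) ζ))
        ((zero_sub _).trans (congrArg Neg.neg (ψ.localConnectionL_apply A hyt _)))
    have hneg : ∀ (T : EuclideanSpace ℝ (Fin r) × EG →L[ℝ] ℝ) (ζ : EG), T (0, -ζ) = -T (0, ζ) := by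
      intro T ζ
      rw [← map_neg]
      simp
    simp only [hbracket, hforce, hneg, ← sub_eq_add_neg]

end LocalTrivialization

end LagrangePoincare

end

theorem mainTheorem3
    {EG : Type*} [NormedAddCommGroup EG] [NormedSpace ℝ EG] [FiniteDimensional ℝ EG]
    {G : Type*} [TopologicalSpace G] [ChartedSpace EG G] [Group G] [LieGroup 𝓘(ℝ, EG) ∞ G]
    {EQ : Type*} [NormedAddCommGroup EQ] [NormedSpace ℝ EQ] [FiniteDimensional ℝ EQ]
    {Q : Type*} [TopologicalSpace Q] [ChartedSpace EQ Q] [IsManifold 𝓘(ℝ, EQ) ∞ Q]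
    [MulAction G Q] [ContMDiffSMul 𝓘(ℝ, EG) 𝓘(ℝ, EQ) ∞ G Q]
    {r m : ℕ} {ι : Type*} [Fintype ι]
    (e : Module.Basis ι ℝ (GroupLieAlgebra 𝓘(ℝ, EG) G))
    (A : LagrangePoincare.PrincipalConnection (EG := EG) (EQ := EQ) G Q)
    (ψ : LagrangePoincare.LocalTrivialization (EG := EG) (EQ := EQ) G Q r)
    (L : TangentBundle 𝓘(ℝ, EQ) Q → ℝ)
    (hL : ContMDiff 𝓘(ℝ, EQ).tangent 𝓘(ℝ, ℝ) 1 L)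
    (hLinv : LagrangePoincare.InvariantLagrangian G L)
    (F : LagrangePoincare.ControlForce (EQ := EQ) Q m)
    (hF : LagrangePoincare.EquivariantForce G F)
    (J : Set ℝ) (hJ : IsOpen J)
    (y : ℝ → EuclideanSpace ℝ (Fin r)) (hyY : ∀ t ∈ J, y t ∈ ψ.base)
    (hy : ∀ t ∈ J, DifferentiableAt ℝ y t)
    (g : ℝ → G) (hg : ∀ t ∈ J, MDifferentiableAt 𝓘(ℝ, ℝ) 𝓘(ℝ, EG) g t)
    (u : ℝ → Fin m → ℝ) :
    ∀ t ∈ J,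
      LagrangePoincare.ForcedEulerLagrangeAt L F (fun s => ψ.toHomeo (y s, g s)) u t ↔
        LagrangePoincare.ForcedLagrangePoincareAt ψ A e L F y g u t := by
  intro t ht
  have hJt := hJ.mem_nhds ht
  exact ψ.forcedEulerLagrangeAt_iff_forcedLagrangePoincareAt A e hL hLinv hF
    (Filter.mem_of_superset hJt hyY) (Filter.mem_of_superset hJt hy)
    (Filter.mem_of_superset hJt hg)
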